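/- Let $G$ be a real Lie group of dimension $r$ with Lie algebra $\mathfrak g$ and basis $v_1,\dots,v_r$ of $\mathfrak g$, and let $M$ be a (Hausdorff) smooth manifold of dimension $p$. For a smooth left or right action of $G$ on $M$ let $$X(v)(z)=\frac{d}{dt}\Big|_{t=0}\exp(tv)\cdot z\in T_zM,\qquad v\in\mathfrak g,$$ be its infinitesimal generators, and let $\{\,,\}$ be the bracket on $C^\infty(M\times\mathfrak g^*,\mathbb R)$ $$\{F,K\}(z,\xi)=\varepsilon\bigl(d_zF\,(X(\delta_\xi K)(z))-d_zK\,(X(\delta_\xi F)(z))\bigr)+\xi([\delta_\xi F,\delta_\xi K]),$$ with $\varepsilon=+1$ for a left and $\varepsilon=-1$ for a right action, where $\delta_\xi F\in\mathfrak g$ is determined by $\nu(\delta_\xi F)=\frac{d}{d\epsilon}|_{\epsilon=0}F(z,\xi+\epsilon\nu)$ for all $\nu\in\mathfrak g^*$. (In coordinates its structure matrix is $\begin{pmatrix}0&\varepsilon\Phi\\-\varepsilon\Phi^T&\Lambda\end{pmatrix}$, with $\Phi$ the matrix of infinitesimals and $\Lambda$ the Lie–Poisson structure matrix of $\mathfrak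 g^*$.) Suppose two actions of $G$ on $M$ are given, each of them left or right, with generators $X^1,X^2$, signs $\varepsilon_1,\varepsilon_2$ and brackets $\{\,,\}_1,\{\,,\}_2$. Put $X=X^1-X^2$ if both are left or both are right actions, and in general $X=X^1-\varepsilon_1\varepsilon_2X^2$. Call the brackets compatible if $\{\,,\}_1$, $\{\,,\}_2$ and $\{\,,\}_1+\{\,,\}_2$ are all Poisson brackets. The rank of $X$ at $z$ is $\dim\{X(v)(z):v\in\mathfrak g\}$. **Theorem.** 1. The brackets are compatible if and only if $[X(v_i),X(v_j)]=0$ on $M$ for all $i,j$; equivalently, $[X(v),X(w)]=0$ on $M$ for all $v,w\in\mathfrak g$. 2. Let $z_0\in M$ be such that the rank of $X$ is constant, equal to $\ell$, near $z_0$, and let $X(v_{\sigma(1)}),\dots,X(v_{\sigma(\ell)})$ be members of the family that are linearly independent at $z_0$. Then all the fields $X(v)$ commute near $z_0$ if and only if the actions differ, near $z_0$ and at the infinitesimal level, by translations along the leaves: there are smooth coordinates $u=(u_1,\dots,u_p)$ around $z_0$ such that $$X(v_{\sigma(i)})=\frac{\partial}{\partial u_i}\ (i\le\ell),\qquad X(v_j)=\sum_{i=1}^{\ell}a_j^i\,\frac{\partial}{\partial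 u_i}\ (j\le r),$$ where the $a_j^i$ are functions of $u_{\ell+1},\dots,u_p$ only. 3. If, moreover, every $X(v)$ that vanishes at $z_0$ vanishes identically near $z_0$ (that is, near $z_0$ the space of vector fields $X(\mathfrak g)$ also has dimension $\ell$), then all the fields $X(v)$ commute near $z_0$ if and only if the actions differ, near $z_0$ and at the infinitesimal level, by a translation: there are coordinates as in part 2 with constant $a_j^i$, so that each $X(v)$ is a constant combination of $\partial/\partial u_1,\dots,\partial/\partial u_\ell$. 4. The brackets are compatible if and only if coordinates as in part 2 exist around every $z_0$ near which the rank is constant, for every choice of members of the family as in part 2. -/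

import Mathlib

open Set Filter Topology
open scoped Manifold ContDiff

noncomputable section

/-- Whether an action is a left action or a right action. -/
inductive ActionSide
  | left
  | right

/-- The sign with which the infinitesimal generators enter the Poisson bracket:
`+1` for left actions, `-1` for right actions. -/
def ActionSide.sign : ActionSide → ℝ
  | .left => 1
  | .right => -1

/-- A smooth left (resp. right) action of an `r`-dimensional Lie group `G` on a
`p`-dimensional manifold `M`. -/
structure LieGroupAction (s : ActionSide) (r p : ℕ)
    (G : Type*) [TopologicalSpace G] [ChartedSpace (EuclideanSpace ℝ (Fin r)) G] [Group G]
    (M : Type*) [TopologicalSpace M] [ChartedSpace (EuclideanSpace ℝ (Fin p)) M] where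
  act : G → M → M
  one_act : ∀ z, act 1 z = z
  act_act : ∀ h g z, act h (act g z) =
    match s with
    | .left => act (h * g) z
    | .right => act (g * h) z
  smooth : ContMDiff ((𝓡 r).prod (𝓡 p)) (𝓡 p) ∞ (fun q : G × M => act q.1 q.2)

/-- The Lie algebra `𝔤 = T_e G` of `G`, with Mathlib's bracket (that of left-invariant fields, so the
commutator for matrix groups). -/
abbrev LieAlg (r : ℕ) (G : Type*) [TopologicalSpace G]
    [ChartedSpace (EuclideanSpace ℝ (Fin r)) G] [Group G] : Type :=
  GroupLieAlgebra (𝓡 r) G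

/-- The dual space `𝔤*`. The vector space `𝔤 = T_e G` is by definition the model space `ℝ^r`, whose
norm makes `𝔤*` a normed space and hence a manifold. -/
abbrev LieCoalg (r : ℕ) : Type := StrongDual ℝ (EuclideanSpace ℝ (Fin r))

section Generators

variable {s s₁ s₂ : ActionSide} {r p : ℕ}
  {G : Type*} [TopologicalSpace G] [ChartedSpace (EuclideanSpace ℝ (Fin r)) G] [Group G]
  {M : Type*} [TopologicalSpace M] [ChartedSpace (EuclideanSpace ℝ (Fin p)) M]

/-- The infinitesimal generators of the action: `v ↦ X(v)(z)` is the differential at `e` of the orbit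
map `g ↦ g · z`. It takes values in `T_{e·z} M`, which is `T_z M` because `e · z = z`. -/
def LieGroupAction.generator (a : LieGroupAction s r p G M) (z : M) :
    LieAlg r G →L[ℝ] TangentSpace (𝓡 p) z :=
  mfderiv (𝓡 r) (𝓡 p) (fun g : G => a.act g z) 1

/-- `X(v)(z)` is the velocity at `t = 0` of `γ(t) · z` for every curve `γ` in `G` through `e` with
velocity `v`, in particular for `γ(t) = exp (t v)`. -/
theorem LieGroupAction.generator_eq_velocity
    (a : LieGroupAction s r p G M) (z : M) (γ : ℝ → G) (v : LieAlg r G) (h0 : γ 0 = 1)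
    (hd : MDifferentiableAt 𝓘(ℝ, ℝ) (𝓡 r) γ 0)
    (hv : (mfderiv 𝓘(ℝ, ℝ) (𝓡 r) γ 0 (1 : ℝ) : EuclideanSpace ℝ (Fin r)) = v) :
    (mfderiv 𝓘(ℝ, ℝ) (𝓡 p) (fun t => a.act (γ t) z) 0 (1 : ℝ) : EuclideanSpace ℝ (Fin p))
      = a.generator z v := by
  have hs : MDifferentiableAt (𝓡 r) (𝓡 p) (fun g : G => a.act g z) (γ 0) := by
    have h := a.smooth.comp
      ((contMDiff_id (I := 𝓡 r) (M := G) (n := ∞)).prodMk (contMDiff_const (c := z)))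
    exact (h.contMDiffAt).mdifferentiableAt (by simp)
  have h := mfderiv_comp (I'' := 𝓡 p) (0 : ℝ) hs hd
  have h' : mfderiv 𝓘(ℝ, ℝ) (𝓡 p) (fun t => a.act (γ t) z) 0 (1 : ℝ)
      = (mfderiv (𝓡 r) (𝓡 p) (fun g : G => a.act g z) (γ 0))
          (mfderiv 𝓘(ℝ, ℝ) (𝓡 r) γ 0 (1 : ℝ)) := by
    change mfderiv 𝓘(ℝ, ℝ) (𝓡 p) ((fun g : G => a.act g z) ∘ γ) 0 (1 : ℝ) = _
    rw [h]; rfl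
  refine h'.trans ?_
  unfold LieGroupAction.generator
  subst hv
  congr 1
  rw [h0]

/-- The difference `X = X¹ - X²` of the generators of two actions of the same kind. If one is a left
and the other a right action, the generators of one of them are first replaced by their negatives
(that is, `g` is replaced by `g⁻¹` in one of the actions), which gives `X = X¹ + X²`. -/
def generatorDiff (a₁ : LieGroupAction s₁ r p G M) (a₂ : LieGroupAction s₂ r p G M) (z : M) :
    LieAlg r G →L[ℝ] TangentSpace (𝓡 p) z :=
  a₁.generator z - (s₁.sign * s₂.sign) • a₂.generator z

end Generators

/-- The differential `δf(ξ) ∈ 𝔤` of a function `f` on `𝔤*`, namely `∑ᵢ (∂f/∂ξᵢ) vᵢ` where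
`ξᵢ` are the coordinates on `𝔤*` associated to a basis `vᵢ` (here the standard one). -/
def coalgGrad {r : ℕ} (f : LieCoalg r → ℝ) (ξ : LieCoalg r) : EuclideanSpace ℝ (Fin r) :=
  ∑ i : Fin r, fderiv ℝ f ξ (EuclideanSpace.proj i) • EuclideanSpace.single i (1 : ℝ)

/-- `δf(ξ)` is the element of `𝔤` with `ν(δf(ξ)) = d/dε f(ξ + ε ν)` for all `ν ∈ 𝔤*`; in particular
it does not depend on the basis. -/
theorem apply_coalgGrad {r : ℕ} (f : LieCoalg r → ℝ) (ξ ν : LieCoalg r) :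
    ν (coalgGrad f ξ) = fderiv ℝ f ξ ν := by
  have h : ν = ∑ i : Fin r, ν (EuclideanSpace.single i (1 : ℝ)) •
      (EuclideanSpace.proj i : LieCoalg r) := by
    ext x
    conv_lhs => rw [← (EuclideanSpace.basisFun (Fin r) ℝ).sum_repr x]
    simp [mul_comm]
  conv_rhs => rw [h]
  simp [coalgGrad, mul_comm]

/-- Poisson brackets on `C^∞(N, ℝ)`; only the values on smooth functions matter. -/
structure IsPoissonBracket {E H : Type*} [NormedAddCommGroup E] [NormedSpace ℝ E]
    [TopologicalSpace H] (I : ModelWithCorners ℝ E H)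
    {N : Type*} [TopologicalSpace N] [ChartedSpace H N]
    (B : (N → ℝ) → (N → ℝ) → (N → ℝ)) : Prop where
  smooth : ∀ F K, ContMDiff I 𝓘(ℝ, ℝ) ∞ F → ContMDiff I 𝓘(ℝ, ℝ) ∞ K →
    ContMDiff I 𝓘(ℝ, ℝ) ∞ (B F K)
  skew : ∀ F K, ContMDiff I 𝓘(ℝ, ℝ) ∞ F → ContMDiff I 𝓘(ℝ, ℝ) ∞ K → B F K = -B K F
  linear : ∀ (a b : ℝ) (F K L), ContMDiff I 𝓘(ℝ, ℝ) ∞ F → ContMDiff I 𝓘(ℝ, ℝ) ∞ K →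
    ContMDiff I 𝓘(ℝ, ℝ) ∞ L → B (a • F + b • K) L = a • B F L + b • B K L
  jacobi : ∀ F K L, ContMDiff I 𝓘(ℝ, ℝ) ∞ F → ContMDiff I 𝓘(ℝ, ℝ) ∞ K →
    ContMDiff I 𝓘(ℝ, ℝ) ∞ L → B F (B K L) + B K (B L F) + B L (B F K) = 0
  leibniz : ∀ F K L, ContMDiff I 𝓘(ℝ, ℝ) ∞ F → ContMDiff I 𝓘(ℝ, ℝ) ∞ K →
    ContMDiff I 𝓘(ℝ, ℝ) ∞ L → B F (K * L) = B F K * L + K * B F L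

/-- Two Poisson brackets are compatible if their sum is a Poisson bracket. -/
def PoissonCompatible {E H : Type*} [NormedAddCommGroup E] [NormedSpace ℝ E]
    [TopologicalSpace H] (I : ModelWithCorners ℝ E H)
    {N : Type*} [TopologicalSpace N] [ChartedSpace H N]
    (B₁ B₂ : (N → ℝ) → (N → ℝ) → (N → ℝ)) : Prop :=
  IsPoissonBracket I B₁ ∧ IsPoissonBracket I B₂ ∧
    IsPoissonBracket I (fun F K => B₁ F K + B₂ F K)

section Bracket

variable {s : ActionSide} {r p : ℕ}
  {G : Type*} [TopologicalSpace G] [ChartedSpace (EuclideanSpace ℝ (Fin r)) G] [Group G]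
  {M : Type*} [TopologicalSpace M] [ChartedSpace (EuclideanSpace ℝ (Fin p)) M]

/-- The bracket on `C^∞(M × 𝔤*, ℝ)` defined by an action,
`{F, K} = ± d_z F (X(δ_ξ K)) ∓ d_z K (X(δ_ξ F)) + ξ([δ_ξ F, δ_ξ K])`
(upper signs for left actions, lower signs for right actions). In coordinates its structure matrix is
`(0, ±Φ; ∓Φᵀ, Λ)` with `Φ` the matrix of infinitesimals and `Λ` the Lie-Poisson matrix. -/
def LieGroupAction.poissonBracket (a : LieGroupAction s r p G M)
    (F K : M × LieCoalg r → ℝ) : M × LieCoalg r → ℝ := fun q =>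
  let dF : TangentSpace (𝓡 p) q.1 →L[ℝ] ℝ :=
    mfderiv (𝓡 p) 𝓘(ℝ, ℝ) (fun z => F (z, q.2)) q.1
  let dK : TangentSpace (𝓡 p) q.1 →L[ℝ] ℝ :=
    mfderiv (𝓡 p) 𝓘(ℝ, ℝ) (fun z => K (z, q.2)) q.1
  let δF : LieAlg r G := coalgGrad (fun ξ => F (q.1, ξ)) q.2
  let δK : LieAlg r G := coalgGrad (fun ξ => K (q.1, ξ)) q.2
  let br : LieAlg r G := ⁅δF, δK⁆
  s.sign * (dF (a.generator q.1 δK) - dK (a.generator q.1 δF)) + q.2 br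

end Bracket

section Translations

variable {r p : ℕ} {V : Type*} [AddCommGroup V] [Module ℝ V] [TopologicalSpace V]
  {M : Type*} [TopologicalSpace M] [ChartedSpace (EuclideanSpace ℝ (Fin p)) M]

/-- The rank at `z` of a linear family `X : V → 𝔛(M)` of vector fields: the dimension of the space of
the values `X(v)(z)`. -/
def familyRank (X : ∀ z : M, V →L[ℝ] TangentSpace (𝓡 p) z) (z : M) : ℕ :=
  Module.finrank ℝ (LinearMap.range (X z).toLinearMap)

/-- The fields `X(v)`, `X(w)` commute at `z` for all `v`, `w`. -/
def CommuteAt (X : ∀ z : M, V →L[ℝ] TangentSpace (𝓡 p) z) (z : M) : Prop :=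
  ∀ v w : V, VectorField.mlieBracket (𝓡 p) (fun y => X y v) (fun y => X y w) z = 0

/-- Around `z₀` there are coordinates `u₁, …, u_p` in which the members `X(b_{σ 1}), …, X(b_{σ ℓ})` of
the family are `∂/∂u₁, …, ∂/∂u_ℓ`, and `X(b_j) = ∑_{i ≤ ℓ} a_{ji} ∂/∂u_i` for all `j`, with
coefficients `a_{ji}` that depend only on `u_{ℓ+1}, …, u_p`. -/
def IsLeafwiseTranslation (X : ∀ z : M, V →L[ℝ] TangentSpace (𝓡 p) z)
    (b : Module.Basis (Fin r) ℝ V) {l : ℕ} (σ : Fin l → Fin r) (z₀ : M) : Prop :=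
  ∃ (hl : l ≤ p) (u : OpenPartialHomeomorph M (EuclideanSpace ℝ (Fin p)))
    (a : Fin r → Fin l → EuclideanSpace ℝ (Fin p) → ℝ),
    u ∈ IsManifold.maximalAtlas (𝓡 p) ∞ M ∧ z₀ ∈ u.source ∧
    (∀ j i, ∀ x ∈ u.target, ∀ y ∈ u.target,
      (∀ k : Fin p, l ≤ (k : ℕ) → x k = y k) → a j i x = a j i y) ∧
    (∀ z ∈ u.source, ∀ i : Fin l, (mfderiv (𝓡 p) (𝓡 p) u z (X z (b (σ i))) :
      EuclideanSpace ℝ (Fin p)) = EuclideanSpace.single (Fin.castLE hl i) 1) ∧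
    (∀ z ∈ u.source, ∀ j : Fin r, (mfderiv (𝓡 p) (𝓡 p) u z (X z (b j)) :
      EuclideanSpace ℝ (Fin p)) =
        ∑ i : Fin l, a j i (u z) • EuclideanSpace.single (Fin.castLE hl i) (1 : ℝ))

/-- As before with constant coefficients: around `z₀` there are coordinates `u₁, …, u_p` in which
`X(b_{σ i}) = ∂/∂u_i` for `i ≤ ℓ` and every member of the family is a constant combination of
`∂/∂u₁, …, ∂/∂u_ℓ`, an infinitesimal translation; those with value `0` at `z₀` are `0`. -/
def IsTranslation (X : ∀ z : M, V →L[ℝ] TangentSpace (𝓡 p) z)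
    (b : Module.Basis (Fin r) ℝ V) {l : ℕ} (σ : Fin l → Fin r) (z₀ : M) : Prop :=
  ∃ (hl : l ≤ p) (u : OpenPartialHomeomorph M (EuclideanSpace ℝ (Fin p)))
    (c : Fin r → Fin l → ℝ),
    u ∈ IsManifold.maximalAtlas (𝓡 p) ∞ M ∧ z₀ ∈ u.source ∧
    (∀ z ∈ u.source, ∀ i : Fin l, (mfderiv (𝓡 p) (𝓡 p) u z (X z (b (σ i))) :
      EuclideanSpace ℝ (Fin p)) = EuclideanSpace.single (Fin.castLE hl i) 1) ∧
    (∀ z ∈ u.source, ∀ j : Fin r, (mfderiv (𝓡 p) (𝓡 p) u z (X z (b j)) :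
      EuclideanSpace ℝ (Fin p)) =
        ∑ i : Fin l, c j i • EuclideanSpace.single (Fin.castLE hl i) (1 : ℝ))

end Translations

end

/-! The proof has an algebraic part, which turns compatibility into commutativity of the fields
`X(v)`, and a geometric part, which describes commuting families of vector fields.

*Compatibility.* Put `Y = -ε X` for the generators `X` of an action of sign `ε`. An action of sign
`ε = 1` becomes a right action on replacing `g` by `g⁻¹`, so in both cases `Y` are the generators of
a right action. They are related by the orbit maps to the left-invariant fields on `G`, hence
`[Y v, Y w] = Y [v, w]`. In terms of `Y` the bracket of the action is
`{F, K} = d_z K (Y δF) - d_z F (Y δK) + c ξ [δF, δK]` with `c = 1`, and the sum of two such brackets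
is of the same form with `Y = Y₁ + Y₂` and `c = 2`. In a chart of `M` this is the bracket of a
bivector field on `ℝ^p × 𝔤*`. Its Jacobiator does not involve second derivatives of the functions,
and equals the sum of `d_z F (N (δK, δL))` over the cyclic permutations of `F, K, L`, where
`N (v, w) = [Y v, Y w] - c Y [v, w]` (`jacobiator_familyBracket`). So the bracket is Poisson if and
only if `N = 0`; for the converse take `F` a function on `M` with prescribed differential at a point
and `K`, `L` linear functions on `𝔤*`. The brackets of the two actions therefore always are Poisson.
For their sum, `[Y₁ v - Y₂ v, Y₁ w - Y₂ w] + [Y₁ v + Y₂ v, Y₁ w + Y₂ w] = 2 Y₁ [v, w] + 2 Y₂ [v, w]`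
shows that `N (v, w) = -[X v, X w]`, where `X = ± (Y₁ - Y₂)` is the difference of the generators
(`poissonCompatible_iff`).

*Normal form.* Let `X₁, …, X_l` be commuting vector fields that are independent at a point `x₀`. The
equation `γ' = ∑ tᵢ Xᵢ(γ)` on the unit interval, with small parameter `t`, is solved by the implicit
function theorem in the space of continuous curves, which gives smooth dependence on `t` and on the
initial value (`exists_contDiffAt_volterra`). Commutativity makes `s ↦ s X_i(γ(s))` a solution of
the equation of first variation, so the value `Ψ(t, y)` of the solution at time one satisfies
`∂Ψ/∂tᵢ = Xᵢ(Ψ)` (`exists_commuting_flow`). With `y` in a slice through `x₀` this gives coordinates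
in which `Xᵢ = ∂/∂uᵢ` (`exists_flowBox`). If the rank is constantly `l`, every other field of the
family is a combination `∑ aᵢ ∂/∂uᵢ`, and since it commutes with `∂/∂u₁, …, ∂/∂u_l` the `aᵢ` do not
depend on `u₁, …, u_l` (`isLeafwiseTranslation_of_commuteAt`). Conversely such fields commute. If the
members of the family that vanish at a point vanish near it, then `X(v) - ∑ aᵢ(z₀) Xᵢ` is zero, so
the coefficients are constant.

*From local to global.* The rank is lower semicontinuous and bounded, so the points near which it is
constant are dense; by continuity the brackets `[X v, X w]` vanish as soon as they vanish near these
points (`commuteAt_of_constant_rank`). -/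

noncomputable section

/-! ### Smooth superposition operators on spaces of continuous maps -/

section Superposition

universe u
variable {K : Type*} [TopologicalSpace K] [CompactSpace K]
  {E F : Type u} [NormedAddCommGroup E] [NormedSpace ℝ E]
  [NormedAddCommGroup F] [NormedSpace ℝ F]

variable (K E F) in
/-- Pointwise evaluation `(A, η) ↦ (k ↦ A k (η k))` as a bounded bilinear map on spaces of
continuous functions. -/
def ContinuousMap.pointwiseApply : C(K, E →L[ℝ] F) →L[ℝ] C(K, E) →L[ℝ] C(K, F) :=
  LinearMap.mkContinuous₂
    (LinearMap.mk₂ ℝ (fun (A : C(K, E →L[ℝ] F)) (η : C(K, E)) =>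
        (⟨fun k => A k (η k), by fun_prop⟩ : C(K, F)))
      (fun _ _ _ => by ext; simp) (fun _ _ _ => by ext; simp)
      (fun _ _ _ => by ext; simp) (fun _ _ _ => by ext; simp)) 1
    (fun A η => by
      refine (ContinuousMap.norm_le _ (by positivity)).2 fun k => ?_
      rw [one_mul]
      exact ((A k).le_opNorm _).trans
        (mul_le_mul (A.norm_coe_le_norm k) (η.norm_coe_le_norm k) (norm_nonneg _) (by positivity)))

@[simp]
theorem ContinuousMap.pointwiseApply_apply (A : C(K, E →L[ℝ] F)) (η : C(K, E)) (k : K) :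
    ContinuousMap.pointwiseApply K E F A η k = A k (η k) := rfl

/-- The superposition operator `γ ↦ f ∘ γ` of a `C¹` function is differentiable, with derivative
the pointwise multiplication by `f' ∘ γ`. -/
theorem ContinuousMap.hasFDerivAt_comp_left (f : C(E, F)) (f' : C(E, E →L[ℝ] F))
    (hf : ∀ x, HasFDerivAt f (f' x) x) (γ : C(K, E)) :
    HasFDerivAt (fun γ : C(K, E) => f.comp γ)
      (ContinuousMap.pointwiseApply K E F (f'.comp γ)) γ := by
  rw [hasFDerivAt_iff_isLittleO_nhds_zero, Asymptotics.isLittleO_iff]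
  intro ε hε
  have hc : Tendsto (fun γ : C(K, E) => f'.comp γ) (𝓝 γ) (𝓝 (f'.comp γ)) :=
    (ContinuousMap.continuous_postcomp f').continuousAt
  rw [ContinuousMap.tendsto_iff_tendstoUniformly, Metric.tendstoUniformly_iff] at hc
  obtain ⟨δ, hδ, hb⟩ := Metric.mem_nhds_iff.1 (hc ε hε)
  filter_upwards [Metric.ball_mem_nhds (0 : C(K, E)) hδ] with η hη
  refine (ContinuousMap.norm_le _ (by positivity)).2 fun k => ?_
  have hseg : ∀ x ∈ segment ℝ (γ k) (γ k + η k), ‖f' x - f' (γ k)‖ ≤ ε := by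
    rintro x hx
    rw [segment_eq_image'] at hx
    obtain ⟨t, ⟨ht0, ht1⟩, rfl⟩ := hx
    have h1 : γ + t • η ∈ Metric.ball γ δ := by
      rw [mem_ball_iff_norm, add_sub_cancel_left, norm_smul, Real.norm_of_nonneg ht0]
      rw [mem_ball_zero_iff] at hη
      exact (mul_le_of_le_one_left (norm_nonneg _) ht1).trans_lt hη
    have h2 := (hb h1 k).le
    rw [dist_comm, dist_eq_norm] at h2
    simpa using h2
  have := (convex_segment (γ k) (γ k + η k)).norm_image_sub_le_of_norm_hasFDerivWithin_le'
    (fun x _ => (hf x).hasFDerivWithinAt) hseg (left_mem_segment ..) (right_mem_segment ..)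
  rw [add_sub_cancel_left] at this
  refine (le_of_eq_of_le ?_ this).trans
    (mul_le_mul_of_nonneg_left (η.norm_coe_le_norm k) hε.le)
  simp

/-- Superposition with a smooth function is a smooth map of spaces of continuous functions. -/
theorem ContinuousMap.contDiff_comp_left (f : C(E, F)) (hf : ContDiff ℝ ∞ f) :
    ContDiff ℝ ∞ (fun γ : C(K, E) => f.comp γ) := by
  rw [contDiff_infty]
  intro n
  induction n generalizing F with
  | zero => exact contDiff_zero.2 (ContinuousMap.continuous_postcomp f)
  | succ n ih =>
    have hf' : ContDiff ℝ ∞ (fderiv ℝ f) := hf.fderiv_right (by simp)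
    let f' : C(E, E →L[ℝ] F) := ⟨fderiv ℝ f, hf'.continuous⟩
    refine contDiff_succ_iff_hasFDerivAt.2
      ⟨fun γ => ContinuousMap.pointwiseApply K E F (f'.comp γ), ?_, fun γ =>
        ContinuousMap.hasFDerivAt_comp_left f f'
          (fun x => (hf.differentiable (by simp) x).hasFDerivAt) γ⟩
    exact (ContinuousMap.pointwiseApply K E F).contDiff.comp (ih f' hf')

end Superposition

/-! ### Smooth local inverses -/

/-- The inverse function theorem with a single neighbourhood on which the inverse is `C^∞`. -/
theorem exists_openPartialHomeomorph_of_hasFDerivAt {E F : Type*}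
    [NormedAddCommGroup E] [NormedSpace ℝ E] [CompleteSpace E]
    [NormedAddCommGroup F] [NormedSpace ℝ F]
    {U : Set E} (hU : IsOpen U) {f : E → F} {f' : E ≃L[ℝ] F} {a : E}
    (hf : ContDiffOn ℝ ∞ f U) (ha : a ∈ U) (hf' : HasFDerivAt f (f' : E →L[ℝ] F) a) :
    ∃ Φ : OpenPartialHomeomorph E F, a ∈ Φ.source ∧ Φ.source ⊆ U ∧ (Φ : E → F) = f ∧
      ContDiffOn ℝ ∞ Φ.symm Φ.target := by
  have hfa : ∀ x ∈ U, ContDiffAt ℝ ∞ f x := fun x hx => (hf x hx).contDiffAt (hU.mem_nhds hx)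
  let Φ₀ := (hfa a ha).toOpenPartialHomeomorph f hf' (by simp)
  have hcont : ContinuousAt (fderiv ℝ f) a :=
    ((hfa a ha).fderiv_right (m := 0) (by simp)).continuousAt
  have hinv : ∀ᶠ x in 𝓝 a, fderiv ℝ f x ∈ range ((↑) : (E ≃L[ℝ] F) → E →L[ℝ] F) :=
    hcont (ContinuousLinearEquiv.isOpen.mem_nhds (by rw [hf'.fderiv]; exact mem_range_self _))
  obtain ⟨W, hW, hWo, haW⟩ := eventually_nhds_iff.1 (hinv.and (hU.mem_nhds ha))
  refine ⟨Φ₀.restrOpen W hWo, ⟨(hfa a ha).mem_toOpenPartialHomeomorph_source hf' _, haW⟩,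
    fun x hx => (hW x hx.2).2, rfl, fun y hy => ContDiffAt.contDiffWithinAt ?_⟩
  have hx := (Φ₀.restrOpen W hWo).map_target hy
  obtain ⟨e, he⟩ := (hW _ hx.2).1
  have hxU := (hW _ hx.2).2
  refine (Φ₀.restrOpen W hWo).contDiffAt_symm (f₀' := e) hy ?_ (hfa _ hxU)
  rw [he]
  exact ((hfa _ hxU).differentiableAt (by simp)).hasFDerivAt

/-! ### A Volterra equation with parameters -/

section Volterra

variable {E P : Type} [NormedAddCommGroup E] [NormedSpace ℝ E]
  [NormedAddCommGroup P] [NormedSpace ℝ P]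

/-- The extension of a function on the unit interval by constants outside of it. -/
abbrev unitExtend (g : C(unitInterval, E)) (τ : ℝ) : E := g (projIcc 0 1 zero_le_one τ)

omit [NormedSpace ℝ E] in
theorem continuous_unitExtend (g : C(unitInterval, E)) : Continuous (unitExtend g) :=
  g.continuous.comp continuous_projIcc

omit [NormedSpace ℝ E] in
theorem unitExtend_coe (g : C(unitInterval, E)) (s : unitInterval) : unitExtend g s = g s := by
  simp [unitExtend]

variable (E) in
/-- The integration operator `g ↦ (s ↦ ∫₀ˢ g)` on continuous functions on the unit interval. -/
def unitIntegral [CompleteSpace E] : C(unitInterval, E) →L[ℝ] C(unitInterval, E) :=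
  LinearMap.mkContinuous
    { toFun := fun g => ⟨fun s => ∫ τ in (0 : ℝ)..s, unitExtend g τ,
        (intervalIntegral.continuous_primitive
          (fun a b => (continuous_unitExtend g).intervalIntegrable a b) 0).comp
          continuous_subtype_val⟩
      map_add' := fun g h => by
        ext s
        exact intervalIntegral.integral_add
          ((continuous_unitExtend g).intervalIntegrable _ _)
          ((continuous_unitExtend h).intervalIntegrable _ _)
      map_smul' := fun c g => by
        ext s
        exact intervalIntegral.integral_smul c _ } 1
    (fun g => by
      refine (ContinuousMap.norm_le _ (by positivity)).2 fun s => ?_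
      refine (intervalIntegral.norm_integral_le_of_norm_le_const
        (C := ‖g‖) fun τ _ => g.norm_coe_le_norm _).trans ?_
      rw [sub_zero, abs_of_nonneg s.2.1, one_mul]
      exact mul_le_of_le_one_right (norm_nonneg _) s.2.2)

theorem unitIntegral_apply [CompleteSpace E] (g : C(unitInterval, E)) (s : unitInterval) :
    unitIntegral E g s = ∫ τ in (0 : ℝ)..s, unitExtend g τ := rfl

variable (E) in
/-- Constant functions on the unit interval. -/
def unitConst : E →L[ℝ] C(unitInterval, E) :=
  LinearMap.mkContinuous
    { toFun := fun y => ContinuousMap.const _ y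
      map_add' := fun _ _ => rfl
      map_smul' := fun _ _ => rfl } 1
    (fun y => (ContinuousMap.norm_le _ (by positivity)).2 fun s => (one_mul ‖y‖).ge)

@[simp]
theorem unitConst_apply (y : E) (s : unitInterval) : unitConst E y s = y := rfl

variable (E P) in
/-- Pairing of a parameter with a curve, `(t, γ) ↦ (s ↦ (t, γ s))`. -/
def unitPair : P × C(unitInterval, E) →L[ℝ] C(unitInterval, P × E) :=
  LinearMap.mkContinuous
    { toFun := fun q => ⟨fun s => (q.1, q.2 s), by fun_prop⟩
      map_add' := fun _ _ => rfl
      map_smul' := fun _ _ => rfl } 1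
    (fun q => (ContinuousMap.norm_le _ (by positivity)).2 fun s => by
      rw [one_mul]
      exact max_le_max le_rfl (q.2.norm_coe_le_norm s))

@[simp]
theorem unitPair_apply (q : P × C(unitInterval, E)) (s : unitInterval) :
    unitPair E P q s = (q.1, q.2 s) := rfl

variable [CompleteSpace E]

/-- The defect of the integral equation `γ = y + ∫ f (t, γ)`. -/
def volterraDefect (f : C(P × E, E)) (q : (P × E) × C(unitInterval, E)) : C(unitInterval, E) :=
  q.2 - unitConst E q.1.2 - unitIntegral E (f.comp (unitPair E P (q.1.1, q.2)))

theorem contDiff_volterraDefect (f : C(P × E, E)) (hf : ContDiff ℝ ∞ f) :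
    ContDiff ℝ ∞ (volterraDefect f) := by
  have h := (ContinuousMap.contDiff_comp_left (K := unitInterval) f hf)
  have h' : ContDiff ℝ ∞ fun q : (P × E) × C(unitInterval, E) =>
      f.comp (unitPair E P (q.1.1, q.2)) :=
    h.comp ((unitPair E P).contDiff.comp (by fun_prop))
  have h2 := (unitIntegral E).contDiff.comp h'
  have h3 : ContDiff ℝ ∞ fun q : (P × E) × C(unitInterval, E) => unitConst E q.1.2 :=
    (unitConst E).contDiff.comp (by fun_prop)
  exact (contDiff_snd.sub h3).sub h2

theorem fderiv_volterraDefect_apply (f : C(P × E, E)) (hf : ContDiff ℝ ∞ f)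
    (q h : (P × E) × C(unitInterval, E)) (s : unitInterval) :
    fderiv ℝ (volterraDefect f) q h s = h.2 s - h.1.2 -
      ∫ τ in (0 : ℝ)..s, fderiv ℝ f (q.1.1, unitExtend q.2 τ) (h.1.1, unitExtend h.2 τ) := by
  let f' : C(P × E, P × E →L[ℝ] E) := ⟨fderiv ℝ f, (hf.fderiv_right (m := ∞) (by simp)).continuous⟩
  let A : (P × E) × C(unitInterval, E) →L[ℝ] P × C(unitInterval, E) :=
    ((ContinuousLinearMap.fst ℝ P E).comp (ContinuousLinearMap.fst ℝ _ _)).prod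
      (ContinuousLinearMap.snd ℝ _ _)
  have h1 := ContinuousMap.hasFDerivAt_comp_left (K := unitInterval) f f'
    (fun x => (hf.differentiable (by simp) x).hasFDerivAt) (unitPair E P (A q))
  have h2 := (unitIntegral E).hasFDerivAt.comp q
    (h1.comp q (((unitPair E P).comp A).hasFDerivAt (x := q)))
  have h3 := ((unitConst E).comp ((ContinuousLinearMap.snd ℝ P E).comp
    (ContinuousLinearMap.fst ℝ _ _))).hasFDerivAt (x := q)
  have h4 : HasFDerivAt (volterraDefect f) _ q := ((hasFDerivAt_snd (p := q)).sub h3).sub h2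
  rw [h4.fderiv]
  rfl

/-- A family of autonomous equations `γ' = f (t, γ)` whose member `t = 0` is trivial has a solution
on the unit interval that depends smoothly on the small parameter `t` and on the initial value.
The derivative of the integral equation with respect to `γ` is the identity at `t = 0`. -/
theorem exists_contDiffAt_volterra [CompleteSpace P] (f : C(P × E, E)) (hf : ContDiff ℝ ∞ f)
    (h0 : ∀ x, f (0, x) = 0) (x₀ : E) :
    ∃ Γ : P × E → C(unitInterval, E), Γ (0, x₀) = unitConst E x₀ ∧
      (∀ᶠ q in 𝓝 ((0, x₀) : P × E), ContDiffAt ℝ ∞ Γ q) ∧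
      ∀ᶠ q in 𝓝 ((0, x₀) : P × E), volterraDefect f (q, Γ q) = 0 := by
  set u : (P × E) × C(unitInterval, E) := ((0, x₀), unitConst E x₀)
  have hu : volterraDefect f u = 0 := by
    ext s
    simp [volterraDefect, u, unitIntegral_apply, unitExtend, h0]
  have hF := contDiff_volterraDefect f hf
  have hd : fderiv ℝ (volterraDefect f) u ∘L .inr ℝ (P × E) C(unitInterval, E)
      = ContinuousLinearMap.id ℝ _ := by
    have h1 : ∀ x v, fderiv ℝ f ((0 : P), x) (0, v) = 0 := by
      intro x v
      have h2 : HasFDerivAt (fun y : E => f ((0 : P), y)) _ x :=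
        ((hf.differentiable (by simp) ((0 : P), x)).hasFDerivAt).comp x
          (hasFDerivAt_prodMk_right (0 : P) x)
      have h3 := h2.fderiv
      simp only [h0, fderiv_fun_const] at h3
      simpa using (DFunLike.congr_fun h3 v).symm
    ext η s
    simp [fderiv_volterraDefect_apply f hf, u, h1]
  have hd' : ∀ η, fderiv ℝ (volterraDefect f) u (0, η) = η := DFunLike.congr_fun hd
  set D := fderiv ℝ (volterraDefect f) u
  have hsplit : ∀ q η, D (q, η) = D (q, 0) + η := fun q η => by
    conv_lhs => rw [show (q, η) = (q, 0) + (0, η) by simp, map_add, hd']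
  -- The derivative of `(q, γ) ↦ (q, defect (q, γ))` at the base point.
  let e : ((P × E) × C(unitInterval, E)) ≃L[ℝ] ((P × E) × C(unitInterval, E)) :=
    ContinuousLinearEquiv.equivOfInverse
      ((ContinuousLinearMap.fst ℝ _ _).prod D)
      ((ContinuousLinearMap.fst ℝ _ _).prod (ContinuousLinearMap.snd ℝ _ _ -
        D.comp ((ContinuousLinearMap.inl ℝ _ _).comp (ContinuousLinearMap.fst ℝ _ _))))
      (fun ⟨q, η⟩ => by simp [hsplit q η]) (fun ⟨q, η⟩ => by simp [hsplit q (η - D (q, 0))])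
  have hdiff : Differentiable ℝ (volterraDefect f) := hF.differentiable (by simp)
  have hT : HasFDerivAt (fun q : (P × E) × C(unitInterval, E) => (q.1, volterraDefect f q))
      (e : _ →L[ℝ] (P × E) × C(unitInterval, E)) u :=
    hasFDerivAt_fst.prodMk (hdiff u).hasFDerivAt
  obtain ⟨Φ, huΦ, -, hΦ, hΦs⟩ := exists_openPartialHomeomorph_of_hasFDerivAt isOpen_univ
    (contDiff_fst.prodMk hF).contDiffOn (mem_univ u) hT
  have hΦu : Φ u = ((0, x₀), 0) := by rw [hΦ]; exact Prod.ext rfl hu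
  have hmem : ∀ᶠ q in 𝓝 ((0, x₀) : P × E), (q, (0 : C(unitInterval, E))) ∈ Φ.target := by
    have hc : ContinuousAt (fun q : P × E => (q, (0 : C(unitInterval, E)))) (0, x₀) := by fun_prop
    have ht : ((0, x₀), 0) ∈ Φ.target := hΦu ▸ Φ.map_source huΦ
    exact hc (Φ.open_target.mem_nhds ht)
  refine ⟨fun q => (Φ.symm (q, 0)).2, ?_, ?_, ?_⟩
  · change (Φ.symm ((0, x₀), 0)).2 = _
    rw [← hΦu, Φ.left_inv huΦ]
  · filter_upwards [hmem] with q hq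
    exact contDiffAt_snd.comp q (((hΦs _ hq).contDiffAt (Φ.open_target.mem_nhds hq)).comp q
      (contDiffAt_id.prodMk contDiffAt_const))
  · filter_upwards [hmem] with q hq
    have h := Φ.right_inv hq
    rw [hΦ] at h
    have h1 : (Φ.symm (q, 0)).1 = q := congrArg Prod.fst h
    have h2 : volterraDefect f (Φ.symm (q, 0)) = 0 := congrArg Prod.snd h
    rwa [← Prod.mk.eta (p := Φ.symm (q, 0)), h1] at h2

end Volterra

/-! ### Simultaneous rectification of commuting vector fields -/

section FlowBox

variable {E P : Type} [NormedAddCommGroup E] [NormedSpace ℝ E] [CompleteSpace E]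
  [NormedAddCommGroup P] [NormedSpace ℝ P] [CompleteSpace P]

omit [CompleteSpace P] in
/-- Uniqueness for the equation of first variation along an integral curve `γ` of `X(t)`: if `X(t)`
and `X(τ)` commute, the solution is `s ↦ s X(τ)(γ(s))`. -/
theorem eq_of_firstVariation {Xm : E → P →L[ℝ] E} (hX : ContDiff ℝ ∞ Xm)
    {γ η : C(unitInterval, E)} {t τ : P} {y : E}
    (hγ : ∀ s : unitInterval, γ s = y + ∫ ρ in (0 : ℝ)..s, Xm (unitExtend γ ρ) t)
    (hcomm : ∀ s, fderiv ℝ Xm (γ s) (Xm (γ s) t) τ = fderiv ℝ Xm (γ s) (Xm (γ s) τ) t)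
    (hsmall : ∀ s, ‖fderiv ℝ Xm (γ s)‖ * ‖t‖ ≤ 1 / 2)
    (hη : ∀ s : unitInterval, η s =
      ∫ σ in (0 : ℝ)..s, (Xm (unitExtend γ σ) τ +
        fderiv ℝ Xm (unitExtend γ σ) (unitExtend η σ) t)) :
    η 1 = Xm (γ 1) τ := by
  have hXd : Differentiable ℝ Xm := hX.differentiable (by simp)
  have hDX : Continuous (fderiv ℝ Xm) := (hX.fderiv_right (m := 0) (by simp)).continuous
  have hγc := continuous_unitExtend γ
  -- the curve and its derivative
  let c : ℝ → E := fun σ => y + ∫ ρ in (0 : ℝ)..σ, Xm (unitExtend γ ρ) t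
  have hcd : ∀ σ, HasDerivAt c (Xm (unitExtend γ σ) t) σ := fun σ => by
    have hint : Continuous fun ρ => Xm (unitExtend γ ρ) t :=
      (hX.continuous.comp hγc).clm_apply continuous_const
    exact (intervalIntegral.integral_hasDerivAt_right (hint.intervalIntegrable _ _)
      (hint.stronglyMeasurableAtFilter _ _) hint.continuousAt).const_add _
  let ζ : C(unitInterval, E) := ⟨fun s => (s : ℝ) • Xm (γ s) τ, by
    have := hX.continuous; fun_prop⟩
  have hζ : ∀ s : unitInterval, ζ s =
      ∫ σ in (0 : ℝ)..s, (Xm (unitExtend γ σ) τ +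
        fderiv ℝ Xm (unitExtend γ σ) (unitExtend ζ σ) t) := by
    intro s
    have hint : Continuous fun σ => Xm (unitExtend γ σ) τ +
        fderiv ℝ Xm (unitExtend γ σ) (unitExtend ζ σ) t := by
      have h1 := hX.continuous
      have h2 := continuous_unitExtend ζ
      fun_prop
    have hder : ∀ σ ∈ uIcc (0 : ℝ) s, HasDerivAt (fun σ => σ • Xm (c σ) τ)
        (Xm (unitExtend γ σ) τ + fderiv ℝ Xm (unitExtend γ σ) (unitExtend ζ σ) t) σ := by
      intro σ hσ
      rw [uIcc_of_le s.2.1] at hσ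
      let σ' : unitInterval := ⟨σ, hσ.1, hσ.2.trans s.2.2⟩
      have e1 : ∀ g : C(unitInterval, E), unitExtend g σ = g σ' := fun g => unitExtend_coe g σ'
      have hcσ : c σ = γ σ' := (hγ σ').symm
      have h1 : HasDerivAt (fun σ => Xm (c σ)) (fderiv ℝ Xm (c σ) (Xm (unitExtend γ σ) t)) σ :=
        (hXd (c σ)).hasFDerivAt.comp_hasDerivAt σ (hcd σ)
      have h2 := (hasDerivAt_id σ).smul (h1.clm_apply (hasDerivAt_const σ τ))
      refine h2.congr_deriv ?_
      rw [e1, e1, hcσ]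
      rw [show ζ σ' = σ • Xm (γ σ') τ from rfl, map_smul, smul_apply,
        ← hcomm σ', map_zero, add_zero, one_smul, add_comm]
      rfl
    have := intervalIntegral.integral_eq_sub_of_hasDerivAt hder (hint.intervalIntegrable _ _)
    rw [this, zero_smul, sub_zero]
    exact congrArg (fun x => (s : ℝ) • Xm x τ) (hγ s)
  have hηζ : ‖η - ζ‖ ≤ 1 / 2 * ‖η - ζ‖ := by
    refine (ContinuousMap.norm_le _ (by positivity)).2 fun s => ?_
    have hint : ∀ g : C(unitInterval, E), Continuous fun σ => Xm (unitExtend γ σ) τ +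
        fderiv ℝ Xm (unitExtend γ σ) (unitExtend g σ) t := fun g => by
      have h1 := hX.continuous
      have h2 := continuous_unitExtend g
      fun_prop
    rw [ContinuousMap.sub_apply, hη, hζ, ← intervalIntegral.integral_sub
      ((hint η).intervalIntegrable _ _) ((hint ζ).intervalIntegrable _ _)]
    refine (intervalIntegral.norm_integral_le_of_norm_le_const
      (C := 1 / 2 * ‖η - ζ‖) fun σ _ => ?_).trans ?_
    · set σ' := projIcc (0 : ℝ) 1 zero_le_one σ
      have h1 : Xm (unitExtend γ σ) τ + fderiv ℝ Xm (unitExtend γ σ) (unitExtend η σ) t -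
          (Xm (unitExtend γ σ) τ + fderiv ℝ Xm (unitExtend γ σ) (unitExtend ζ σ) t) =
          fderiv ℝ Xm (γ σ') ((η - ζ) σ') t := by
        simp [unitExtend, σ']
      rw [h1]
      calc _ ≤ ‖fderiv ℝ Xm (γ σ') ((η - ζ) σ')‖ * ‖t‖ := ContinuousLinearMap.le_opNorm _ _
        _ ≤ (‖fderiv ℝ Xm (γ σ')‖ * ‖(η - ζ) σ'‖) * ‖t‖ := by
          gcongr; exact ContinuousLinearMap.le_opNorm _ _
        _ = (‖fderiv ℝ Xm (γ σ')‖ * ‖t‖) * ‖(η - ζ) σ'‖ := by ring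
        _ ≤ _ := mul_le_mul (hsmall σ') ((η - ζ).norm_coe_le_norm σ')
          (norm_nonneg _) (by norm_num)
    · rw [sub_zero, abs_of_nonneg s.2.1]
      exact mul_le_of_le_one_right (by positivity) s.2.2
  have h0 : η = ζ := by
    rw [← sub_eq_zero, ← norm_eq_zero]
    linarith [norm_nonneg (η - ζ)]
  rw [h0]
  exact one_smul ℝ _

/-- For a linear family of commuting fields `X(t)` let `Ψ (t, y)` be the value at time one of the
integral curve of `X(t)` through `y`. Then `∂Ψ/∂t` in direction `τ` is `X(τ)` at `Ψ`: along the
curve `γ` of `X(t)`, both `∂γ/∂t` and `s ↦ s X(τ)(γ(s))` solve the equation of first variation. -/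
theorem exists_commuting_flow {Xm : E → P →L[ℝ] E} (hX : ContDiff ℝ ∞ Xm) {U : Set E}
    (hU : IsOpen U) {x₀ : E} (hx₀ : x₀ ∈ U)
    (hcomm : ∀ x ∈ U, ∀ t τ, fderiv ℝ Xm x (Xm x t) τ = fderiv ℝ Xm x (Xm x τ) t) :
    ∃ Ψ : P × E → E, (∀ᶠ q in 𝓝 ((0, x₀) : P × E), ContDiffAt ℝ ∞ Ψ q) ∧
      (∀ᶠ y in 𝓝 x₀, Ψ (0, y) = y) ∧
      ∀ᶠ q in 𝓝 ((0, x₀) : P × E), Ψ q ∈ U ∧ ∀ τ, fderiv ℝ Ψ q (τ, 0) = Xm (Ψ q) τ := by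
  have hfc : ContDiff ℝ ∞ fun q : P × E => Xm q.2 q.1 :=
    (hX.comp contDiff_snd).clm_apply contDiff_fst
  have hXd : Differentiable ℝ Xm := hX.differentiable (by simp)
  have hDX : Continuous (fderiv ℝ Xm) := (hX.fderiv_right (m := 0) (by simp)).continuous
  let f : C(P × E, E) := ⟨fun q => Xm q.2 q.1, hfc.continuous⟩
  have hfd : ∀ t x τ v, fderiv ℝ f (t, x) (τ, v) = Xm x τ + fderiv ℝ Xm x v t := by
    intro t x τ v
    have h1 : HasFDerivAt (fun q : P × E => Xm q.2) _ (t, x) :=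
      (hXd x).hasFDerivAt.comp (t, x) hasFDerivAt_snd
    have h2 : HasFDerivAt f _ (t, x) := h1.clm_apply hasFDerivAt_fst
    rw [h2.fderiv]
    simp
  obtain ⟨Γ, hΓ0, hΓd, hΓ⟩ := exists_contDiffAt_volterra f hfc (fun x => by simp [f]) x₀
  let ev : C(unitInterval, E) →L[ℝ] E := ContinuousMap.evalCLM ℝ (1 : unitInterval)
  refine ⟨fun q => ev (Γ q), ?_, ?_, ?_⟩
  · filter_upwards [hΓd] with q hq using ev.contDiff.contDiffAt.comp q hq
  · have hc : ContinuousAt (fun y : E => ((0, y) : P × E)) x₀ := by fun_prop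
    filter_upwards [hc hΓ] with y hy
    have := DFunLike.congr_fun hy (1 : unitInterval)
    simpa [volterraDefect, unitIntegral_apply, unitExtend, f, sub_eq_zero, ev] using this
  -- Near the base point the curves stay where the fields commute and the equation of first
  -- variation is contracting.
  obtain ⟨δ, hδ, hball⟩ : ∃ δ > 0, ∀ t x, dist (t, x) ((0, x₀) : P × E) < δ →
      x ∈ U ∧ ‖fderiv ℝ Xm x‖ * ‖t‖ < 1 / 2 := by
    have h1 : ∀ᶠ q in 𝓝 ((0, x₀) : P × E), q.2 ∈ U ∧ ‖fderiv ℝ Xm q.2‖ * ‖q.1‖ < 1 / 2 := by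
      refine (continuousAt_snd.eventually (hU.mem_nhds hx₀)).and ?_
      have hc : Continuous fun q : P × E => ‖fderiv ℝ Xm q.2‖ * ‖q.1‖ := by
        have h1 : Continuous fun q : P × E => ‖fderiv ℝ Xm q.2‖ :=
          Continuous.norm (E := E →L[ℝ] P →L[ℝ] E) (hDX.comp continuous_snd)
        exact h1.mul continuous_fst.norm
      exact hc.continuousAt.eventually_lt continuousAt_const (by simp)
    obtain ⟨δ, hδ, h⟩ := Metric.eventually_nhds_iff.1 h1
    exact ⟨δ, hδ, fun t x htx => h htx⟩
  have hclose : ∀ᶠ q in 𝓝 ((0, x₀) : P × E), ∀ s, dist (q.1, Γ q s) ((0, x₀) : P × E) < δ := by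
    have hc : ContinuousAt Γ (0, x₀) := hΓd.self_of_nhds.continuousAt
    filter_upwards [Metric.ball_mem_nhds ((0, x₀) : P × E) hδ,
      hc.eventually (Metric.ball_mem_nhds (Γ (0, x₀)) hδ)] with q hq1 hq2 s
    refine max_lt ((le_max_left _ _).trans_lt hq1) ?_
    have := (ContinuousMap.dist_apply_le_dist s).trans_lt hq2
    rwa [hΓ0] at this
  filter_upwards [hclose, hΓd, hΓ.eventually_nhds] with q hq hqd hqΓ
  refine ⟨(hball _ _ (hq 1)).1, fun τ => ?_⟩
  have hΓq : HasFDerivAt Γ (fderiv ℝ Γ q) q := (hqd.differentiableAt (by simp)).hasFDerivAt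
  have hev : HasFDerivAt (fun q => ev (Γ q)) (ev.comp (fderiv ℝ Γ q)) q :=
    ev.hasFDerivAt.comp q hΓq
  rw [hev.fderiv]
  change fderiv ℝ Γ q (τ, 0) 1 = Xm (Γ q 1) τ
  set γ := Γ q
  set η := fderiv ℝ Γ q (τ, 0)
  -- the equation of first variation
  have hη : ∀ s : unitInterval, η s =
      ∫ σ in (0 : ℝ)..s, (Xm (unitExtend γ σ) τ +
        fderiv ℝ Xm (unitExtend γ σ) (unitExtend η σ) q.1) := by
    intro s
    have hF := (contDiff_volterraDefect f hfc).differentiable (by simp) (q, γ)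
    have h1 := hF.hasFDerivAt.comp q ((hasFDerivAt_id q).prodMk hΓq)
    have h2 : HasFDerivAt (fun q => volterraDefect f (q, Γ q)) (0 : P × E →L[ℝ] _) q :=
      (hasFDerivAt_const (0 : C(unitInterval, E)) q).congr_of_eventuallyEq hqΓ
    have h3 := DFunLike.congr_fun (DFunLike.congr_fun (h1.unique h2) (τ, 0)) s
    have h4 : fderiv ℝ (volterraDefect f) (q, γ) ((τ, 0), η) s = 0 := h3
    rw [fderiv_volterraDefect_apply f hfc] at h4
    simp only [hfd, sub_zero, sub_eq_zero] at h4
    exact h4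
  have hγ : ∀ s : unitInterval,
      γ s = q.2 + ∫ ρ in (0 : ℝ)..s, Xm (unitExtend γ ρ) q.1 := fun s => by
    have h : γ s - q.2 - ∫ ρ in (0 : ℝ)..s, Xm (unitExtend γ ρ) q.1 = 0 :=
      DFunLike.congr_fun hqΓ.self_of_nhds s
    rwa [sub_sub, sub_eq_zero] at h
  exact eq_of_firstVariation hX hγ (fun s => hcomm _ (hball _ _ (hq s)).1 _ _)
    (fun s => (hball _ _ (hq s)).2.le) hη

end FlowBox

section FlowBoxCoordinates

/-- A smooth map on an open set agrees near any given point of it with a globally smooth map. -/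
theorem exists_contDiff_eventuallyEq {E F : Type*} [NormedAddCommGroup E] [NormedSpace ℝ E]
    [FiniteDimensional ℝ E] [NormedAddCommGroup F] [NormedSpace ℝ F] {U : Set E} (hU : IsOpen U)
    {f : E → F} (hf : ContDiffOn ℝ ∞ f U) {x₀ : E} (hx₀ : x₀ ∈ U) :
    ∃ g : E → F, ContDiff ℝ ∞ g ∧ g =ᶠ[𝓝 x₀] f := by
  obtain ⟨δ, hδ, hball⟩ := Metric.isOpen_iff.1 hU x₀ hx₀
  let χ : ContDiffBump x₀ := ⟨δ / 4, δ / 2, by positivity, by linarith⟩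
  refine ⟨fun x => χ x • f x,
    contMDiff_iff_contDiff.1 (contMDiff_of_tsupport fun x hx => contMDiffAt_iff_contDiffAt.2 ?_),
    ?_⟩
  · have hx1 : x ∈ tsupport χ := closure_mono (Function.support_smul_subset_left _ _) hx
    rw [χ.tsupport_eq] at hx1
    have hxU : x ∈ U := hball (lt_of_le_of_lt hx1 (by change δ / 2 < δ; linarith))
    exact χ.contDiffAt.smul ((hf x hxU).contDiffAt (hU.mem_nhds hxU))
  · filter_upwards [χ.eventuallyEq_one] with x hx
    simp [hx]

variable {p l : ℕ}

/-- The linear family of vector fields `t ↦ ∑ tᵢ Xᵢ` spanned by the fields `Xᵢ`. -/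
def fieldSpan (X : Fin l → EuclideanSpace ℝ (Fin p) → EuclideanSpace ℝ (Fin p))
    (x : EuclideanSpace ℝ (Fin p)) : EuclideanSpace ℝ (Fin l) →L[ℝ] EuclideanSpace ℝ (Fin p) :=
  ∑ i, (EuclideanSpace.proj i : EuclideanSpace ℝ (Fin l) →L[ℝ] ℝ).smulRight (X i x)

theorem fieldSpan_apply (X : Fin l → EuclideanSpace ℝ (Fin p) → EuclideanSpace ℝ (Fin p))
    (x : EuclideanSpace ℝ (Fin p)) (t : EuclideanSpace ℝ (Fin l)) :
    fieldSpan X x t = ∑ i, t i • X i x := by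
  simp [fieldSpan]

theorem contDiff_fieldSpan {X : Fin l → EuclideanSpace ℝ (Fin p) → EuclideanSpace ℝ (Fin p)}
    (hX : ∀ i, ContDiff ℝ ∞ (X i)) : ContDiff ℝ ∞ (fieldSpan X) := by
  unfold fieldSpan
  have := fun i => hX i
  fun_prop

theorem fderiv_fieldSpan_apply {X : Fin l → EuclideanSpace ℝ (Fin p) → EuclideanSpace ℝ (Fin p)}
    (hX : ∀ i, ContDiff ℝ ∞ (X i)) (x v : EuclideanSpace ℝ (Fin p))
    (t : EuclideanSpace ℝ (Fin l)) :
    fderiv ℝ (fieldSpan X) x v t = ∑ i, t i • fderiv ℝ (X i) x v := by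
  have h1 := ((contDiff_fieldSpan hX).differentiable (by simp) x).hasFDerivAt.clm_apply
    (hasFDerivAt_const t x)
  have h2 : HasFDerivAt (fun x => fieldSpan X x t) (∑ i, t i • fderiv ℝ (X i) x) x := by
    simp only [fieldSpan_apply]
    exact HasFDerivAt.fun_sum fun i _ =>
      (((hX i).differentiable (by simp) x).hasFDerivAt).const_smul (t i)
  have := DFunLike.congr_fun (h1.unique h2) v
  simpa [sum_apply] using this

/-- Linear coordinates that start with a given linearly independent family. -/
theorem exists_continuousLinearEquiv_single {w : Fin l → EuclideanSpace ℝ (Fin p)}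
    (hw : LinearIndependent ℝ w) : ∃ (hl : l ≤ p)
      (A : EuclideanSpace ℝ (Fin p) ≃L[ℝ] EuclideanSpace ℝ (Fin p)),
      ∀ i, A (EuclideanSpace.single (Fin.castLE hl i) 1) = w i := by
  have hl : l ≤ p := by simpa using hw.fintype_card_le_finrank
  obtain ⟨κ, B, hB⟩ : ∃ (κ : Fin l ↪ Fin p)
      (B : Module.Basis (Fin p) ℝ (EuclideanSpace ℝ (Fin p))), ∀ i, B (κ i) = w i := by
    let B := Module.Basis.sumExtend hw
    have hfin : Finite (Fin l ⊕ Module.Basis.sumExtendIndex hw) := Module.Finite.finite_basis B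
    have hcard : Nat.card (Fin l ⊕ Module.Basis.sumExtendIndex hw) = p := by
      rw [← Module.finrank_eq_nat_card_basis B]; simp
    let e := Finite.equivFinOfCardEq hcard
    refine ⟨⟨fun i => e (Sum.inl i), fun i j h => by simpa using h⟩, B.reindex e, fun i => ?_⟩
    change B.reindex e (e (Sum.inl i)) = w i
    rw [Module.Basis.reindex_apply, e.symm_apply_apply]
    simp only [B, Module.Basis.sumExtend, Module.Basis.reindex_apply,
      Module.Basis.extend_apply_self]
    rfl
  obtain ⟨π, hπ⟩ : ∃ π : Equiv.Perm (Fin p), ∀ i, π (Fin.castLE hl i) = κ i := by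
    let ι := Fin.castLEEmb hl
    obtain ⟨π, hπ⟩ := Equiv.Perm.exists_extending_pair ι κ ι.injective κ.injective
    exact ⟨π, hπ⟩
  let A := (EuclideanSpace.basisFun (Fin p) ℝ).toBasis.equiv B π
  refine ⟨hl, A.toContinuousLinearEquiv, fun i => ?_⟩
  have h := (EuclideanSpace.basisFun (Fin p) ℝ).toBasis.equiv_apply (Fin.castLE hl i) B π
  rw [hπ, hB] at h
  simpa using h

/-- Commuting vector fields that are linearly independent at a point are coordinate fields in
suitable coordinates around it. -/
theorem exists_flowBox {X : Fin l → EuclideanSpace ℝ (Fin p) → EuclideanSpace ℝ (Fin p)}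
    {U : Set (EuclideanSpace ℝ (Fin p))} (hU : IsOpen U) {x₀ : EuclideanSpace ℝ (Fin p)}
    (hx₀ : x₀ ∈ U) (hX : ∀ i, ContDiffOn ℝ ∞ (X i) U)
    (hcomm : ∀ x ∈ U, ∀ i j, VectorField.lieBracket ℝ (X i) (X j) x = 0)
    (hli : LinearIndependent ℝ fun i => X i x₀) :
    ∃ (hl : l ≤ p)
      (Θ : OpenPartialHomeomorph (EuclideanSpace ℝ (Fin p)) (EuclideanSpace ℝ (Fin p))),
      x₀ ∈ Θ.target ∧ Θ.target ⊆ U ∧ Convex ℝ Θ.source ∧ ContDiffOn ℝ ∞ Θ Θ.source ∧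
      ContDiffOn ℝ ∞ Θ.symm Θ.target ∧
      ∀ u ∈ Θ.source, ∀ i,
        fderiv ℝ Θ u (EuclideanSpace.single (Fin.castLE hl i) 1) = X i (Θ u) := by
  choose Y hY hYX using fun i => exists_contDiff_eventuallyEq hU (hX i) hx₀
  obtain ⟨W, hW, hWo, hxW⟩ : ∃ W : Set (EuclideanSpace ℝ (Fin p)),
      (∀ x ∈ W, x ∈ U ∧ ∀ i, Y i =ᶠ[𝓝 x] X i) ∧ IsOpen W ∧ x₀ ∈ W :=
    eventually_nhds_iff.1 ((hU.eventually_mem hx₀).and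
      (eventually_all.2 fun i => (hYX i).eventuallyEq_nhds))
  have hYc : ∀ x ∈ W, ∀ i j, fderiv ℝ (Y j) x (Y i x) = fderiv ℝ (Y i) x (Y j x) := by
    intro x hx i j
    have h := hcomm x (hW x hx).1 i j
    rw [← ((hW x hx).2 i).lieBracket_vectorField_eq ((hW x hx).2 j),
      VectorField.lieBracket_eq, sub_eq_zero] at h
    exact h
  obtain ⟨Ψ, hΨd, hΨ0, hΨ⟩ := exists_commuting_flow (contDiff_fieldSpan hY) hWo hxW (by
    intro x hx t τ
    rw [fderiv_fieldSpan_apply hY, fderiv_fieldSpan_apply hY]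
    simp only [fieldSpan_apply, map_sum, map_smul, Finset.smul_sum]
    rw [Finset.sum_comm]
    refine Finset.sum_congr rfl fun i _ => Finset.sum_congr rfl fun j _ => ?_
    rw [hYc x hx i j, smul_comm])
  have hYx₀ : ∀ i, Y i x₀ = X i x₀ := fun i => (hYX i).self_of_nhds
  obtain ⟨hl, A, hA⟩ := exists_continuousLinearEquiv_single hli
  -- `Θ u` is the flow in time `(u₁, …, u_l)` of a point of the slice through `x₀` spanned by the
  -- remaining coordinate directions.
  let π : EuclideanSpace ℝ (Fin p) →L[ℝ] EuclideanSpace ℝ (Fin l) :=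
    LinearMap.toContinuousLinearMap
      { toFun := fun u => WithLp.toLp 2 fun i => u (Fin.castLE hl i)
        map_add' := fun _ _ => rfl
        map_smul' := fun _ _ => rfl }
  have hπ : ∀ u i, π u i = u (Fin.castLE hl i) := fun _ _ => rfl
  let S : EuclideanSpace ℝ (Fin p) →L[ℝ] EuclideanSpace ℝ (Fin p) :=
    (A : EuclideanSpace ℝ (Fin p) →L[ℝ] EuclideanSpace ℝ (Fin p)) - (fieldSpan X x₀).comp π
  have hπs : ∀ i, π (EuclideanSpace.single (Fin.castLE hl i) 1) = EuclideanSpace.single i 1 := by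
    intro i
    ext j
    simp [hπ, Fin.ext_iff]
  have hS : ∀ i, S (EuclideanSpace.single (Fin.castLE hl i) 1) = 0 := by
    intro i
    simp [S, hA, hπs, fieldSpan_apply]
  let q : EuclideanSpace ℝ (Fin p) → EuclideanSpace ℝ (Fin l) × EuclideanSpace ℝ (Fin p) :=
    fun u => (π u, x₀ + S u)
  have hq : ∀ u, HasFDerivAt q (π.prod S) u := fun u =>
    π.hasFDerivAt.prodMk (S.hasFDerivAt.const_add x₀)
  have hqc : Continuous q := by fun_prop
  have hq0 : q 0 = (0, x₀) := by simp [q]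
  have hnhds : ∀ {φ : EuclideanSpace ℝ (Fin l) × EuclideanSpace ℝ (Fin p) → Prop},
      (∀ᶠ q in 𝓝 (0, x₀), φ q) → ∀ᶠ u in 𝓝 0, φ (q u) := fun h =>
    hqc.continuousAt.eventually (hq0.symm ▸ h)
  have hgood : ∀ᶠ u in 𝓝 (0 : EuclideanSpace ℝ (Fin p)), ContDiffAt ℝ ∞ Ψ (q u) ∧
      Ψ (q u) ∈ W ∧ ∀ τ, fderiv ℝ Ψ (q u) (τ, 0) = fieldSpan Y (Ψ (q u)) τ := by
    exact hnhds (hΨd.and hΨ)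
  obtain ⟨V, hV, hVo, h0V⟩ := eventually_nhds_iff.1 hgood
  have hΘd : ∀ u ∈ V, HasFDerivAt (fun u => Ψ (q u)) ((fderiv ℝ Ψ (q u)).comp (π.prod S)) u :=
    fun u hu => (((hV u hu).1.differentiableAt (by simp)).hasFDerivAt).comp u (hq u)
  have hΘc : ContDiffOn ℝ ∞ (fun u => Ψ (q u)) V := fun u hu =>
    ((hV u hu).1.comp u (by fun_prop)).contDiffWithinAt
  have hΨx₀ : Ψ (q 0) = x₀ := by rw [hq0]; exact hΨ0.self_of_nhds
  -- at the origin the derivative is `A`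
  have hD0 : (fderiv ℝ Ψ (q 0)).comp (π.prod S) =
      (A : EuclideanSpace ℝ (Fin p) →L[ℝ] EuclideanSpace ℝ (Fin p)) := by
    have hsnd : ∀ v, fderiv ℝ Ψ (q 0) (0, v) = v := by
      intro v
      have h0 := ((hV 0 h0V).1.differentiableAt (by simp)).hasFDerivAt
      rw [hq0] at h0 ⊢
      have h1 := h0.comp x₀ (hasFDerivAt_prodMk_right (0 : EuclideanSpace ℝ (Fin l)) x₀)
      have h2 := (hasFDerivAt_id (𝕜 := ℝ) x₀).congr_of_eventuallyEq hΨ0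
      simpa using DFunLike.congr_fun (h1.unique h2) v
    ext1 u
    have h3 : (π.prod S) u = (π u, 0) + (0, S u) := by simp
    rw [ContinuousLinearMap.comp_apply, h3, map_add, hsnd, (hV 0 h0V).2.2, hΨx₀]
    simp [S, fieldSpan_apply, hYx₀]
  obtain ⟨Θ, h0Θ, hΘV, hΘ, hΘs⟩ := exists_openPartialHomeomorph_of_hasFDerivAt hVo hΘc h0V
    (f' := A) (hD0 ▸ hΘd 0 h0V)
  obtain ⟨δ, hδ, hball⟩ := Metric.isOpen_iff.1 Θ.open_source 0 h0Θ
  let Θ' := Θ.restrOpen (Metric.ball 0 δ) Metric.isOpen_ball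
  have hsrc : Θ'.source = Metric.ball 0 δ := inter_eq_right.2 hball
  have hΘ' : (Θ' : EuclideanSpace ℝ (Fin p) → _) = fun u => Ψ (q u) := hΘ
  have hsV : Θ'.source ⊆ V := fun u hu => hΘV hu.1
  have h0 : (0 : EuclideanSpace ℝ (Fin p)) ∈ Θ'.source := hsrc ▸ Metric.mem_ball_self hδ
  refine ⟨hl, Θ', ?_, ?_, hsrc ▸ convex_ball _ _, ?_, hΘs.mono inter_subset_left, ?_⟩
  · have hx : Θ' 0 = x₀ := hΘ' ▸ hΨx₀
    exact hx ▸ Θ'.map_source h0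
  · intro x hx
    have hu := hsV (Θ'.map_target hx)
    rw [← Θ'.right_inv hx, hΘ']
    exact (hW _ (hV _ hu).2.1).1
  · rw [hΘ']
    exact hΘc.mono hsV
  · intro u hu i
    have hu' := hsV hu
    rw [hΘ', (hΘd u hu').fderiv, ContinuousLinearMap.comp_apply, ContinuousLinearMap.prod_apply,
      hS, hπs, (hV u hu').2.2, fieldSpan_apply]
    simp [((hW _ (hV u hu').2.1).2 i).self_of_nhds]

end FlowBoxCoordinates

/-! ### Vector fields in charts -/

section ChartRep

variable {p : ℕ}
  {M : Type*} [TopologicalSpace M] [ChartedSpace (EuclideanSpace ℝ (Fin p)) M]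
  [IsManifold (𝓡 p) ∞ M]

/-- Smoothness of a vector field, as a section of the tangent bundle. -/
abbrev SmoothField (V : Π z : M, TangentSpace (𝓡 p) z) : Prop :=
  ContMDiff (𝓡 p) (𝓡 p).tangent ∞ fun z => (⟨z, V z⟩ : TangentBundle (𝓡 p) M)

/-- The differential of a chart, with values in the model space. -/
def chartDeriv (φ : OpenPartialHomeomorph M (EuclideanSpace ℝ (Fin p))) (z : M) :
    TangentSpace (𝓡 p) z →L[ℝ] EuclideanSpace ℝ (Fin p) :=
  mfderiv (𝓡 p) (𝓡 p) φ z

/-- The local expression of a vector field in a chart. -/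
def chartRep (φ : OpenPartialHomeomorph M (EuclideanSpace ℝ (Fin p)))
    (V : Π z : M, TangentSpace (𝓡 p) z) (x : EuclideanSpace ℝ (Fin p)) :
    EuclideanSpace ℝ (Fin p) :=
  chartDeriv φ (φ.symm x) (V (φ.symm x))

theorem mlieBracket_eq_lieBracket {V W : Π x : EuclideanSpace ℝ (Fin p), TangentSpace (𝓡 p) x} :
    VectorField.mlieBracket (𝓡 p) V W = VectorField.lieBracket ℝ V W := by
  rw [← VectorField.mlieBracketWithin_univ, VectorField.mlieBracketWithin_eq_lieBracketWithin]
  exact VectorField.lieBracketWithin_univ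

omit [IsManifold (𝓡 p) ∞ M] in
theorem chartRep_apply {φ : OpenPartialHomeomorph M (EuclideanSpace ℝ (Fin p))}
    {V : Π z : M, TangentSpace (𝓡 p) z} {z : M} (hz : z ∈ φ.source) :
    chartRep φ V (φ z) = chartDeriv φ z (V z) := by
  have h : ∀ y, y = z → chartDeriv φ y (V y) = chartDeriv φ z (V z) := by rintro _ rfl; rfl
  exact h _ (φ.left_inv hz)

variable {φ : OpenPartialHomeomorph M (EuclideanSpace ℝ (Fin p))}
  (hφ : φ ∈ IsManifold.maximalAtlas (𝓡 p) ∞ M)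
include hφ

omit [IsManifold (𝓡 p) ∞ M] in
theorem mdifferentiable_of_mem_maximalAtlas : φ.MDifferentiable (𝓡 p) (𝓡 p) :=
  ⟨fun z hz => ((contMDiffAt_of_mem_maximalAtlas hφ hz).mdifferentiableAt
      (by simp)).mdifferentiableWithinAt,
    fun x hx => ((contMDiffAt_symm_of_mem_maximalAtlas hφ hx).mdifferentiableAt
      (by simp)).mdifferentiableWithinAt⟩

omit [IsManifold (𝓡 p) ∞ M] in
theorem chartDeriv_injective {z : M} (hz : z ∈ φ.source) :
    Function.Injective (chartDeriv φ z) :=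
  ((mdifferentiable_of_mem_maximalAtlas hφ).mfderiv_bijective hz).1

omit [IsManifold (𝓡 p) ∞ M] in
theorem isInvertible_mfderiv_symm {x : EuclideanSpace ℝ (Fin p)} (hx : x ∈ φ.target) :
    (mfderiv (𝓡 p) (𝓡 p) φ.symm x).IsInvertible :=
  ⟨(mdifferentiable_of_mem_maximalAtlas hφ).symm.mfderiv hx, rfl⟩

omit [IsManifold (𝓡 p) ∞ M] in
/-- The local expression of a vector field is its pullback by the inverse of the chart. -/
theorem chartRep_eq_mpullback (V : Π z : M, TangentSpace (𝓡 p) z)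
    {x : EuclideanSpace ℝ (Fin p)} (hx : x ∈ φ.target) :
    chartRep φ V x = VectorField.mpullback (𝓡 p) (𝓡 p) φ.symm V x := by
  have h := mdifferentiable_of_mem_maximalAtlas hφ
  have h1 := h.comp_symm_deriv hx
  have h2 := h.symm_comp_deriv (φ.map_target hx)
  rw [φ.right_inv hx] at h2
  have h3 := ContinuousLinearMap.inverse_eq h2 h1
  rw [VectorField.mpullback_apply, h3]
  rfl

theorem contDiffOn_chartRep {V : Π z : M, TangentSpace (𝓡 p) z} (hV : SmoothField V) :
    ContDiffOn ℝ ∞ (chartRep φ V) φ.target := by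
  intro x hx
  refine ContDiffAt.contDiffWithinAt ?_
  have h := ContMDiffAt.mpullback_vectorField_preimage (hV (φ.symm x))
    (contMDiffAt_symm_of_mem_maximalAtlas hφ hx) (isInvertible_mfderiv_symm hφ hx) (by simp)
  rw [contMDiffAt_vectorSpace_iff_contDiffAt] at h
  refine h.congr_of_eventuallyEq ?_
  filter_upwards [φ.open_target.mem_nhds hx] with y hy
  exact chartRep_eq_mpullback hφ V hy

/-- The local expression of the bracket is the bracket of the local expressions. -/
theorem chartDeriv_mlieBracket {V W : Π z : M, TangentSpace (𝓡 p) z}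
    (hV : SmoothField V) (hW : SmoothField W) {z : M} (hz : z ∈ φ.source) :
    chartDeriv φ z (VectorField.mlieBracket (𝓡 p) V W z) =
      VectorField.lieBracket ℝ (chartRep φ V) (chartRep φ W) (φ z) := by
  have hx := φ.map_source hz
  have : IsManifold (𝓡 p) (minSmoothness ℝ 3) M := by
    rw [minSmoothness_of_isRCLikeNormedField]; infer_instance
  have h1 := VectorField.mpullback_mlieBracket (n := ∞) (V := V) (W := W)
    ((hV _).mdifferentiableAt (by simp)) ((hW _).mdifferentiableAt (by simp))
    (contMDiffAt_symm_of_mem_maximalAtlas hφ hx)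
    (by rw [minSmoothness_of_isRCLikeNormedField]; exact ENat.LEInfty.out)
  rw [← chartRep_eq_mpullback hφ _ hx, chartRep_apply hz] at h1
  refine (h1.trans (congrFun mlieBracket_eq_lieBracket _)).trans ?_
  have h : ∀ V : Π z : M, TangentSpace (𝓡 p) z,
      VectorField.mpullback (𝓡 p) (𝓡 p) φ.symm V =ᶠ[𝓝 (φ z)] chartRep φ V := fun V => by
    filter_upwards [φ.open_target.mem_nhds hx] with y hy
    exact (chartRep_eq_mpullback hφ V hy).symm
  exact Filter.EventuallyEq.lieBracket_vectorField_eq (𝕜 := ℝ) (E := EuclideanSpace ℝ (Fin p))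
    (h V) (h W)

end ChartRep

section Related

variable {n p : ℕ}
  {N : Type*} [TopologicalSpace N] [ChartedSpace (EuclideanSpace ℝ (Fin n)) N]
  {M : Type*} [TopologicalSpace M] [ChartedSpace (EuclideanSpace ℝ (Fin p)) M]

/-- Brackets of related vector fields are related. -/
theorem mfderiv_mlieBracket_of_related [IsManifold (𝓡 n) ∞ N] [IsManifold (𝓡 p) ∞ M] {f : N → M}
    (hf : ContMDiff (𝓡 n) (𝓡 p) ∞ f)
    {V W : Π z : N, TangentSpace (𝓡 n) z} {V' W' : Π z : M, TangentSpace (𝓡 p) z}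
    (hV : SmoothField V) (hW : SmoothField W) (hV' : SmoothField V') (hW' : SmoothField W')
    (hVV' : ∀ z, mfderiv (𝓡 n) (𝓡 p) f z (V z) = V' (f z))
    (hWW' : ∀ z, mfderiv (𝓡 n) (𝓡 p) f z (W z) = W' (f z)) (z : N) :
    mfderiv (𝓡 n) (𝓡 p) f z (VectorField.mlieBracket (𝓡 n) V W z) =
      VectorField.mlieBracket (𝓡 p) V' W' (f z) := by
  set χ := chartAt (EuclideanSpace ℝ (Fin n)) z
  set φ := chartAt (EuclideanSpace ℝ (Fin p)) (f z)
  have hχ : χ ∈ IsManifold.maximalAtlas (𝓡 n) ∞ N := IsManifold.chart_mem_maximalAtlas z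
  have hφ : φ ∈ IsManifold.maximalAtlas (𝓡 p) ∞ M := IsManifold.chart_mem_maximalAtlas (f z)
  have hz : z ∈ χ.source := mem_chart_source _ z
  have hfz : f z ∈ φ.source := mem_chart_source _ (f z)
  have hx := χ.map_source hz
  let g : EuclideanSpace ℝ (Fin n) → EuclideanSpace ℝ (Fin p) := φ ∘ f ∘ χ.symm
  have hfd : ∀ z, MDifferentiableAt (𝓡 n) (𝓡 p) f z := fun z =>
    (hf z).mdifferentiableAt (by simp)
  have hnear : ∀ᶠ x in 𝓝 (χ z), x ∈ χ.target ∧ f (χ.symm x) ∈ φ.source := by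
    refine (χ.open_target.eventually_mem hx).and ?_
    have hc : ContinuousAt (f ∘ χ.symm) (χ z) :=
      hf.continuous.continuousAt.comp (χ.continuousAt_symm hx)
    exact hc (φ.open_source.mem_nhds (by simpa [χ.left_inv hz] using hfz))
  -- local expressions are related by `g`
  have hgm : ∀ x, x ∈ χ.target → f (χ.symm x) ∈ φ.source →
      ContMDiffAt (𝓡 n) (𝓡 p) ∞ g x := fun x hx hfx =>
    (contMDiffAt_of_mem_maximalAtlas hφ hfx).comp x
      ((hf _).comp x (contMDiffAt_symm_of_mem_maximalAtlas hχ hx))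
  have key0 : ∀ y ∈ χ.source, f y ∈ φ.source → ∀ v : TangentSpace (𝓡 n) y,
      fderiv ℝ g (χ y) (chartDeriv χ y v) = chartDeriv φ (f y) (mfderiv (𝓡 n) (𝓡 p) f y v) := by
    intro y hy hfy v
    have hgf : g ∘ χ =ᶠ[𝓝 y] φ ∘ f := by
      filter_upwards [χ.open_source.mem_nhds hy] with y hy
      simp [g, χ.left_inv hy]
    have hχd : MDifferentiableAt (𝓡 n) (𝓡 n) χ y :=
      (mdifferentiable_of_mem_maximalAtlas hχ).mdifferentiableAt hy
    have hφd : MDifferentiableAt (𝓡 p) (𝓡 p) φ (f y) :=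
      (mdifferentiable_of_mem_maximalAtlas hφ).mdifferentiableAt hfy
    have hgd : MDifferentiableAt (𝓡 n) (𝓡 p) g (χ y) :=
      (hgm _ (χ.map_source hy) (by rwa [χ.left_inv hy])).mdifferentiableAt (by simp)
    have h1 := hgf.mfderiv_eq (I := 𝓡 n) (I' := 𝓡 p)
    rw [mfderiv_comp _ hgd hχd, mfderiv_comp _ hφd (hfd _), mfderiv_eq_fderiv] at h1
    exact DFunLike.congr_fun h1 v
  have hgd : ContDiffAt ℝ ∞ g (χ z) :=
    contMDiffAt_iff_contDiffAt.1 (hgm _ hnear.self_of_nhds.1 hnear.self_of_nhds.2)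
  have hgz : g (χ z) = φ (f z) := by simp [g, χ.left_inv hz]
  have hd : ∀ {V : Π z : N, TangentSpace (𝓡 n) z}, SmoothField V →
      DifferentiableAt ℝ (chartRep χ V) (χ z) := fun hV =>
    ((contDiffOn_chartRep hχ hV).contDiffAt (χ.open_target.mem_nhds hx)).differentiableAt (by simp)
  have hd' : ∀ {V : Π z : M, TangentSpace (𝓡 p) z}, SmoothField V →
      DifferentiableAt ℝ (chartRep φ V) (g (χ z)) := fun hV => by
    rw [hgz]
    exact ((contDiffOn_chartRep hφ hV).contDiffAt
      (φ.open_target.mem_nhds (φ.map_source hfz))).differentiableAt (by simp)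
  -- differentiating `Dg (V) = V' ∘ g` in a direction `v`
  have key : ∀ {W : Π z : N, TangentSpace (𝓡 n) z} {W' : Π z : M, TangentSpace (𝓡 p) z},
      SmoothField W' → (∀ z, mfderiv (𝓡 n) (𝓡 p) f z (W z) = W' (f z)) → ∀ v,
      fderiv ℝ (fun x => fderiv ℝ g x (chartRep χ W x)) (χ z) v =
        fderiv ℝ (chartRep φ W') (φ (f z)) (fderiv ℝ g (χ z) v) := by
    intro W W' hW' h v
    have h1 : (fun x => fderiv ℝ g x (chartRep χ W x)) =ᶠ[𝓝 (χ z)] chartRep φ W' ∘ g := by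
      filter_upwards [hnear] with x hx
      have h2 := key0 (χ.symm x) (χ.map_target hx.1) hx.2 (W (χ.symm x))
      rw [χ.right_inv hx.1, h, ← chartRep_apply hx.2] at h2
      exact h2
    rw [h1.fderiv_eq, fderiv_comp _ (hd' hW') (hgd.differentiableAt (by simp)), ← hgz]
    rfl
  have hval : ∀ {V : Π z : N, TangentSpace (𝓡 n) z} {V' : Π z : M, TangentSpace (𝓡 p) z},
      (∀ z, mfderiv (𝓡 n) (𝓡 p) f z (V z) = V' (f z)) →
      fderiv ℝ g (χ z) (chartRep χ V (χ z)) = chartRep φ V' (φ (f z)) := by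
    intro V V' h
    rw [chartRep_apply hz, key0 z hz hfz, h, ← chartRep_apply hfz]
  apply chartDeriv_injective hφ hfz
  rw [chartDeriv_mlieBracket hφ hV' hW' hfz, ← key0 z hz hfz, chartDeriv_mlieBracket hχ hV hW hz,
    VectorField.fderiv_apply_lieBracket hgd
      (by rw [minSmoothness_of_isRCLikeNormedField]; exact ENat.LEInfty.out) (hd hW) (hd hV),
    key hW' hWW', key hV' hVV', hval hVV', hval hWW', VectorField.lieBracket_eq]

end Related

/-! ### Normal forms of commuting families -/

section NormalForm

variable {r p l : ℕ} {V : Type*} [AddCommGroup V] [Module ℝ V] [TopologicalSpace V]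
  {M : Type*} [TopologicalSpace M] [ChartedSpace (EuclideanSpace ℝ (Fin p)) M]
  [IsManifold (𝓡 p) ∞ M]
  {X : ∀ z : M, V →L[ℝ] TangentSpace (𝓡 p) z} {b : Module.Basis (Fin r) ℝ V}
  {σ : Fin l → Fin r} {z₀ : M}

omit [IsManifold (𝓡 p) ∞ M] in
/-- Where the rank is `l`, any `l` independent values span all values of the family. -/
theorem exists_eq_sum_of_familyRank_eq {w : Fin l → V} {z : M} (hr : familyRank X z = l)
    (hli : LinearIndependent ℝ fun i => X z (w i)) (v : V) :
    ∃ c : Fin l → ℝ, X z v = ∑ i, c i • X z (w i) := by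
  have : FiniteDimensional ℝ (TangentSpace (𝓡 p) z) :=
    inferInstanceAs (FiniteDimensional ℝ (EuclideanSpace ℝ (Fin p)))
  have hle : Submodule.span ℝ (range fun i => X z (w i)) ≤ LinearMap.range (X z).toLinearMap := by
    rw [Submodule.span_le]
    rintro _ ⟨i, rfl⟩
    exact ⟨w i, rfl⟩
  have heq := Submodule.eq_of_le_of_finrank_eq hle (by
    rw [finrank_span_eq_card hli, Fintype.card_fin]; exact hr.symm)
  have hv : X z v ∈ Submodule.span ℝ (range fun i => X z (w i)) := heq ▸ ⟨v, rfl⟩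
  obtain ⟨c, hc⟩ := (Submodule.mem_span_range_iff_exists_fun ℝ).1 hv
  exact ⟨c, hc.symm⟩

/-- A smooth function on a convex open set whose derivative vanishes in the first `l` coordinate
directions depends on the remaining coordinates only. -/
theorem eq_of_fderiv_single_eq_zero {F : Type*} [NormedAddCommGroup F] [NormedSpace ℝ F]
    (hl : l ≤ p) {T : Set (EuclideanSpace ℝ (Fin p))} (hT : Convex ℝ T)
    {f : EuclideanSpace ℝ (Fin p) → F} (hf : ∀ x ∈ T, DifferentiableAt ℝ f x)
    (h : ∀ x ∈ T, ∀ i : Fin l, fderiv ℝ f x (EuclideanSpace.single (Fin.castLE hl i) 1) = 0)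
    {x y : EuclideanSpace ℝ (Fin p)} (hx : x ∈ T) (hy : y ∈ T)
    (hxy : ∀ k : Fin p, l ≤ (k : ℕ) → x k = y k) : f x = f y := by
  have hdir : ∀ z ∈ T, fderiv ℝ f z (y - x) = 0 := by
    intro z hz
    have h1 : y - x = ∑ k, (y - x) k • EuclideanSpace.single k (1 : ℝ) := by
      conv_lhs => rw [← (EuclideanSpace.basisFun (Fin p) ℝ).sum_repr (y - x)]
      simp
    rw [h1, map_sum]
    refine Finset.sum_eq_zero fun k _ => ?_
    rw [map_smul]
    by_cases hk : l ≤ (k : ℕ)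
    · simp [hxy k hk]
    · rw [show k = Fin.castLE hl ⟨k, not_le.1 hk⟩ from rfl, h z hz, smul_zero]
  have hmem : ∀ t ∈ Icc (0 : ℝ) 1, x + t • (y - x) ∈ T := fun t ht =>
    hT.add_smul_sub_mem hx hy ht
  have hder : ∀ t ∈ Icc (0 : ℝ) 1, HasDerivAt (fun t : ℝ => f (x + t • (y - x))) 0 t := by
    intro t ht
    have h1 : HasDerivAt (fun t : ℝ => x + t • (y - x)) (y - x) t := by
      simpa using ((hasDerivAt_id t).smul_const (y - x)).const_add x
    have h2 := (hf _ (hmem t ht)).hasFDerivAt.comp_hasDerivAt t h1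
    rwa [hdir _ (hmem t ht)] at h2
  have := constant_of_has_deriv_right_zero
    (fun t ht => (hder t ht).continuousAt.continuousWithinAt)
    (fun t ht => (hder t (Ico_subset_Icc_self ht)).hasDerivWithinAt) 1 (right_mem_Icc.2 zero_le_one)
  simpa using this.symm

/-- Around a point near which the rank is constant, a commuting family consists of translations
along the leaves. -/
theorem isLeafwiseTranslation_of_commuteAt (hX : ∀ v, SmoothField fun z => X z v)
    (hr : ∀ᶠ z in 𝓝 z₀, familyRank X z = l)
    (hli : LinearIndependent ℝ fun i => X z₀ (b (σ i)))
    (hc : ∀ᶠ z in 𝓝 z₀, CommuteAt X z) : IsLeafwiseTranslation X b σ z₀ := by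
  set φ := chartAt (EuclideanSpace ℝ (Fin p)) z₀
  have hφ : φ ∈ IsManifold.maximalAtlas (𝓡 p) ∞ M := IsManifold.chart_mem_maximalAtlas z₀
  have hz₀ : z₀ ∈ φ.source := mem_chart_source _ z₀
  obtain ⟨W, hW, hWo, hzW⟩ := eventually_nhds_iff.1 (hr.and hc)
  set U := φ.target ∩ φ.symm ⁻¹' W
  have hU : IsOpen U := φ.isOpen_inter_preimage_symm hWo
  have hxU : φ z₀ ∈ U := ⟨φ.map_source hz₀, by simpa [φ.left_inv hz₀] using hzW⟩
  have hli' : LinearIndependent ℝ fun i => chartRep φ (fun z => X z (b (σ i))) (φ z₀) := by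
    simp only [chartRep_apply hz₀]
    exact hli.map' (chartDeriv φ z₀).toLinearMap
      (LinearMap.ker_eq_bot.2 (chartDeriv_injective hφ hz₀))
  obtain ⟨hl, Θ, hxΘ, hΘU, hconv, hΘ, hΘs, hΘX⟩ := exists_flowBox hU hxU
    (fun i => (contDiffOn_chartRep hφ (hX (b (σ i)))).mono inter_subset_left)
    (fun x hx i j => by
      have h := chartDeriv_mlieBracket hφ (hX (b (σ i))) (hX (b (σ j))) (φ.map_target hx.1)
      rw [φ.right_inv hx.1, (hW _ hx.2).2, map_zero] at h
      exact h.symm) hli'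
  set u := φ.trans Θ.symm
  have husrc : ∀ {z}, z ∈ u.source → z ∈ φ.source ∧ φ z ∈ Θ.target := fun hz => by
    simpa [u] using hz
  have hutgt : u.target = Θ.source := by
    ext x
    simp only [u, OpenPartialHomeomorph.trans_target, OpenPartialHomeomorph.symm_target,
      OpenPartialHomeomorph.symm_symm, mem_inter_iff, mem_preimage, and_iff_left_iff_imp]
    exact fun hx => (hΘU (Θ.map_source hx)).1
  have huW : ∀ {z}, z ∈ u.source → z ∈ W := fun hz => by
    have h := (hΘU (husrc hz).2).2
    rwa [mem_preimage, φ.left_inv (husrc hz).1] at h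
  have hu : u ∈ IsManifold.maximalAtlas (𝓡 p) ∞ M := by
    refine u.mem_maximalAtlas_of_contMDiffOn ?_ ?_
    · exact (contMDiffOn_iff_contDiffOn.2 hΘs).comp
        ((contMDiffOn_of_mem_maximalAtlas hφ).mono inter_subset_left) (fun z hz => (husrc hz).2)
    · rw [hutgt]
      exact (contMDiffOn_symm_of_mem_maximalAtlas hφ).comp (contMDiffOn_iff_contDiffOn.2 hΘ)
        (fun x hx => (hΘU (Θ.map_source hx)).1)
  have hz₀u : z₀ ∈ u.source := by
    simpa [u] using And.intro hz₀ hxΘ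
  have hd : ∀ {x}, x ∈ Θ.source → DifferentiableAt ℝ Θ x := fun hx =>
    (hΘ.contDiffAt (Θ.open_source.mem_nhds hx)).differentiableAt (by simp)
  have hds : ∀ {x}, x ∈ Θ.target → DifferentiableAt ℝ Θ.symm x := fun hx =>
    (hΘs.contDiffAt (Θ.open_target.mem_nhds hx)).differentiableAt (by simp)
  -- in the coordinates `u` the selected fields are coordinate fields
  have hcoord : ∀ z ∈ u.source, ∀ i,
      chartDeriv u z (X z (b (σ i))) = EuclideanSpace.single (Fin.castLE hl i) 1 := by
    intro z hz i
    obtain ⟨hzφ, hzΘ⟩ := husrc hz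
    have h1 : ∀ v, chartDeriv u z v = fderiv ℝ Θ.symm (φ z) (chartDeriv φ z v) := by
      intro v
      have h := mfderiv_comp (I := 𝓡 p) (I' := 𝓡 p) (I'' := 𝓡 p) z
        (hds hzΘ).mdifferentiableAt
        ((mdifferentiable_of_mem_maximalAtlas hφ).mdifferentiableAt hzφ)
      rw [mfderiv_eq_fderiv] at h
      exact DFunLike.congr_fun h v
    have h2 : fderiv ℝ Θ.symm (φ z) (fderiv ℝ Θ (Θ.symm (φ z))
        (EuclideanSpace.single (Fin.castLE hl i) 1)) =
          EuclideanSpace.single (Fin.castLE hl i) 1 := by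
      have hx := Θ.map_target hzΘ
      have h0 : HasFDerivAt Θ.symm (fderiv ℝ Θ.symm (φ z)) (Θ (Θ.symm (φ z))) := by
        rw [Θ.right_inv hzΘ]
        exact (hds hzΘ).hasFDerivAt
      have h3 := h0.comp _ (hd hx).hasFDerivAt
      have h4 : Θ.symm ∘ Θ =ᶠ[𝓝 (Θ.symm (φ z))] id := by
        filter_upwards [Θ.open_source.mem_nhds hx] with y hy using Θ.left_inv hy
      exact DFunLike.congr_fun (h3.unique ((hasFDerivAt_id _).congr_of_eventuallyEq h4)) _
    rw [hΘX _ (Θ.map_target hzΘ), Θ.right_inv hzΘ, chartRep_apply hzφ] at h2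
    rw [h1, h2]
  have hsum : ∀ z ∈ u.source, ∀ j, chartDeriv u z (X z (b j)) =
      ∑ i : Fin l, chartRep u (fun z => X z (b j)) (u z) (Fin.castLE hl i) •
        EuclideanSpace.single (Fin.castLE hl i) (1 : ℝ) := by
    intro z hz j
    have hliz : LinearIndependent ℝ fun i => X z (b (σ i)) := by
      refine LinearIndependent.of_comp (chartDeriv u z).toLinearMap ?_
      have : (chartDeriv u z).toLinearMap ∘ (fun i => X z (b (σ i))) =
          fun i => (EuclideanSpace.basisFun (Fin p) ℝ).toBasis (Fin.castLE hl i) := by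
        ext1 i
        simpa using hcoord z hz i
      rw [this]
      exact (EuclideanSpace.basisFun (Fin p) ℝ).toBasis.linearIndependent.comp _
        (Fin.castLE_injective hl)
    obtain ⟨c, hc⟩ := exists_eq_sum_of_familyRank_eq (hW z (huW hz)).1 hliz (b j)
    have h1 : chartDeriv u z (X z (b j)) =
        ∑ i : Fin l, c i • EuclideanSpace.single (Fin.castLE hl i) (1 : ℝ) := by
      rw [hc, map_sum]
      exact Finset.sum_congr rfl fun i _ => by rw [map_smul, hcoord z hz]
    rw [chartRep_apply hz, h1]
    refine Finset.sum_congr rfl fun i _ => ?_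
    congr 1
    simp [Finset.sum_apply, Pi.single_apply]
  refine ⟨hl, u, fun j i x => chartRep u (fun z => X z (b j)) x (Fin.castLE hl i), hu, hz₀u,
    ?_, hcoord, hsum⟩
  intro j i x hx y hy hxy
  have hsm := fun v => contDiffOn_chartRep hu (hX v)
  refine congrArg (fun w : EuclideanSpace ℝ (Fin p) => w (Fin.castLE hl i))
    (eq_of_fderiv_single_eq_zero hl (hutgt ▸ hconv : Convex ℝ u.target)
      (fun x hx => ((hsm (b j)).contDiffAt (u.open_target.mem_nhds hx)).differentiableAt (by simp))
      (fun x hx k => ?_) hx hy hxy)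
  -- `∂ₖ` and `X(bⱼ)` commute
  have hzx := u.map_target hx
  have h := chartDeriv_mlieBracket hu (hX (b (σ k))) (hX (b j)) hzx
  rw [(hW _ (huW hzx)).2, map_zero, u.right_inv hx, VectorField.lieBracket_eq] at h
  have hconst : chartRep u (fun z => X z (b (σ k))) =ᶠ[𝓝 x]
      fun _ => EuclideanSpace.single (Fin.castLE hl k) (1 : ℝ) := by
    filter_upwards [u.open_target.mem_nhds hx] with y hy
    exact hcoord _ (u.map_target hy) k
  simp only [hconst.fderiv_eq, hconst.self_of_nhds, fderiv_fun_const, Pi.zero_apply,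
    zero_apply, sub_zero] at h
  exact h.symm

omit [IsManifold (𝓡 p) ∞ M] in
theorem chartDeriv_eq_sum_repr (u : OpenPartialHomeomorph M (EuclideanSpace ℝ (Fin p))) (z : M)
    (v : V) : chartDeriv u z (X z v) = ∑ j, b.repr v j • chartDeriv u z (X z (b j)) := by
  conv_lhs => rw [← b.sum_repr v]
  simp only [map_sum, map_smul]

/-- Translations along the leaves commute: the coefficients are constant along the leaves, to which
all fields are tangent. -/
theorem IsLeafwiseTranslation.eventually_commuteAt (hX : ∀ v, SmoothField fun z => X z v)
    (h : IsLeafwiseTranslation X b σ z₀) : ∀ᶠ z in 𝓝 z₀, CommuteAt X z := by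
  obtain ⟨hl, u, a, hu, hz₀, ha, -, hsum⟩ := h
  change ∀ z ∈ u.source, ∀ j, chartDeriv u z (X z (b j)) = _ at hsum
  have hrep : ∀ v, ∀ x ∈ u.target, chartRep u (fun z => X z v) x = ∑ j, b.repr v j •
      ∑ i : Fin l, a j i x • EuclideanSpace.single (Fin.castLE hl i) (1 : ℝ) := by
    intro v x hx
    change chartDeriv u (u.symm x) (X (u.symm x) v) = _
    rw [chartDeriv_eq_sum_repr (b := b)]
    refine Finset.sum_congr rfl fun j _ => ?_
    rw [hsum _ (u.map_target hx), u.right_inv hx]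
  have hdiff : ∀ v, ∀ x ∈ u.target, DifferentiableAt ℝ (chartRep u fun z => X z v) x :=
    fun v x hx => ((contDiffOn_chartRep hu (hX v)).contDiffAt
      (u.open_target.mem_nhds hx)).differentiableAt (by simp)
  have hzero : ∀ w, ∀ x ∈ u.target, ∀ i : Fin l, fderiv ℝ (chartRep u fun z => X z w) x
      (EuclideanSpace.single (Fin.castLE hl i) 1) = 0 := by
    intro w x hx i
    let e : EuclideanSpace ℝ (Fin p) := EuclideanSpace.single (Fin.castLE hl i) 1
    have hline : HasDerivAt (fun t : ℝ => x + t • e) e 0 := by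
      simpa using ((hasDerivAt_id (0 : ℝ)).smul_const e).const_add x
    have h0 : HasFDerivAt (chartRep u fun z => X z w)
        (fderiv ℝ (chartRep u fun z => X z w) x) (x + (0 : ℝ) • e) := by
      simpa using (hdiff w x hx).hasFDerivAt
    have h1 := h0.comp_hasDerivAt 0 hline
    have h2 : (chartRep u fun z => X z w) ∘ (fun t : ℝ => x + t • e) =ᶠ[𝓝 0]
        fun _ => chartRep u (fun z => X z w) x := by
      have hx0 : x + (0 : ℝ) • e ∈ u.target := by simpa using hx
      filter_upwards [hline.continuousAt.eventually_mem (u.open_target.mem_nhds hx0)] with t ht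
      rw [Function.comp_apply, hrep w _ ht, hrep w x hx]
      refine Finset.sum_congr rfl fun j _ => congrArg _ (Finset.sum_congr rfl fun i' _ => ?_)
      rw [ha j i' _ ht x hx fun k hk => ?_]
      have hne : k ≠ Fin.castLE hl i := by
        rintro rfl
        exact absurd i.2 (not_lt.2 hk)
      simp [e, hne]
    exact h1.unique ((hasDerivAt_const _ _).congr_of_eventuallyEq h2)
  have htan : ∀ v w, ∀ x ∈ u.target, fderiv ℝ (chartRep u fun z => X z w) x
      (chartRep u (fun z => X z v) x) = 0 := by
    intro v w x hx
    rw [hrep v x hx]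
    simp [map_sum, hzero w x hx]
  filter_upwards [u.open_source.mem_nhds hz₀] with z hz v w
  apply chartDeriv_injective hu hz
  rw [chartDeriv_mlieBracket hu (hX v) (hX w) hz, map_zero, VectorField.lieBracket_eq]
  simp only
  rw [htan v w _ (u.map_source hz), htan w v _ (u.map_source hz), sub_zero]

omit [IsManifold (𝓡 p) ∞ M] in
theorem IsTranslation.isLeafwiseTranslation (h : IsTranslation X b σ z₀) :
    IsLeafwiseTranslation X b σ z₀ := by
  obtain ⟨hl, u, c, hu, hz₀, hσ, hsum⟩ := h
  exact ⟨hl, u, fun j i _ => c j i, hu, hz₀, fun _ _ _ _ _ _ _ => rfl, hσ, hsum⟩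

/-- If the members of the family vanishing at the point vanish near it, the coefficients of a
leafwise translation are constant: `X(bⱼ) - ∑ᵢ aⱼᵢ(z₀) X(b_{σ i})` vanishes at `z₀`. -/
theorem IsLeafwiseTranslation.isTranslation
    (hvan : ∀ v : V, X z₀ v = 0 → ∀ᶠ z in 𝓝 z₀, X z v = 0)
    (h : IsLeafwiseTranslation X b σ z₀) : IsTranslation X b σ z₀ := by
  obtain ⟨hl, u, a, hu, hz₀, -, hσ, hsum⟩ := h
  change ∀ z ∈ u.source, ∀ i, chartDeriv u z (X z (b (σ i))) = _ at hσ
  change ∀ z ∈ u.source, ∀ j, chartDeriv u z (X z (b j)) = _ at hsum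
  have hcomb : ∀ z ∈ u.source, ∀ j, chartDeriv u z (X z (∑ i, a j i (u z₀) • b (σ i))) =
      ∑ i, a j i (u z₀) • EuclideanSpace.single (Fin.castLE hl i) (1 : ℝ) := by
    intro z hz j
    simp only [map_sum, map_smul]
    exact Finset.sum_congr rfl fun i _ => by rw [hσ z hz]
  have hnear : ∀ᶠ z in 𝓝 z₀, ∀ j, X z (b j - ∑ i, a j i (u z₀) • b (σ i)) = 0 :=
    eventually_all.2 fun j => hvan _ <| chartDeriv_injective hu hz₀ <| by
      rw [map_sub, map_sub, hsum z₀ hz₀, hcomb z₀ hz₀, sub_self, map_zero]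
  obtain ⟨W, hW, hWo, hzW⟩ := eventually_nhds_iff.1 hnear
  refine ⟨hl, u.restrOpen W hWo, fun j i => a j i (u z₀), ?_, ⟨hz₀, hzW⟩,
    fun z hz i => hσ z hz.1 i, fun z hz j => ?_⟩
  · exact (u.restrOpen W hWo).mem_maximalAtlas_of_contMDiffOn
      ((contMDiffOn_of_mem_maximalAtlas hu).mono inter_subset_left)
      ((contMDiffOn_symm_of_mem_maximalAtlas hu).mono inter_subset_left)
  · have h1 := hW z hz.2 j
    rw [map_sub, sub_eq_zero] at h1
    change chartDeriv u z (X z (b j)) = _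
    rw [h1, hcomb z hz.1]

omit [IsManifold (𝓡 p) ∞ M] in
/-- The values at a point of suitable members of the family form a basis of all values. -/
theorem exists_linearIndependent_familyRank (b : Module.Basis (Fin r) ℝ V) (z : M) :
    ∃ σ : Fin (familyRank X z) → Fin r, LinearIndependent ℝ fun i => X z (b (σ i)) := by
  have : FiniteDimensional ℝ (TangentSpace (𝓡 p) z) :=
    inferInstanceAs (FiniteDimensional ℝ (EuclideanSpace ℝ (Fin p)))
  obtain ⟨κ, f, hf, hspan, hli⟩ := exists_linearIndependent' ℝ fun j => X z (b j)
  have : Finite κ := Finite.of_injective f hf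
  have : Fintype κ := Fintype.ofFinite κ
  have hrange : LinearMap.range (X z).toLinearMap =
      Submodule.span ℝ (range fun j => X z (b j)) := by
    rw [LinearMap.range_eq_map, ← b.span_eq, Submodule.map_span, ← range_comp]
    rfl
  have hcard : familyRank X z = Fintype.card κ := by
    rw [familyRank, hrange, ← hspan, finrank_span_eq_card hli]
  let e := Fintype.equivFinOfCardEq hcard.symm
  exact ⟨f ∘ e.symm, hli.comp e.symm e.symm.injective⟩

/-- The rank is lower semicontinuous. -/
theorem eventually_le_familyRank (hX : ∀ v, SmoothField fun z => X z v)
    (b : Module.Basis (Fin r) ℝ V) (z₀ : M) :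
    ∀ᶠ z in 𝓝 z₀, familyRank X z₀ ≤ familyRank X z := by
  obtain ⟨σ, hσ⟩ := exists_linearIndependent_familyRank (X := X) b z₀
  set φ := chartAt (EuclideanSpace ℝ (Fin p)) z₀
  have hφ : φ ∈ IsManifold.maximalAtlas (𝓡 p) ∞ M := IsManifold.chart_mem_maximalAtlas z₀
  have hz₀ : z₀ ∈ φ.source := mem_chart_source _ z₀
  have hcont : ContinuousAt (fun z i => chartRep φ (fun z => X z (b (σ i))) (φ z)) z₀ :=
    continuousAt_pi.2 fun i => ContinuousAt.comp
      ((contDiffOn_chartRep hφ (hX (b (σ i)))).continuousOn.continuousAt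
        (φ.open_target.mem_nhds (φ.map_source hz₀))) (φ.continuousAt hz₀)
  have hli : LinearIndependent ℝ fun i => chartRep φ (fun z => X z (b (σ i))) (φ z₀) := by
    simp only [chartRep_apply hz₀]
    exact hσ.map' (chartDeriv φ z₀).toLinearMap
      (LinearMap.ker_eq_bot.2 (chartDeriv_injective hφ hz₀))
  filter_upwards [φ.open_source.mem_nhds hz₀,
    hcont.eventually_mem (isOpen_setOfPred_linearIndependent.mem_nhds hli)] with z hz hliz
  have : FiniteDimensional ℝ (TangentSpace (𝓡 p) z) :=
    inferInstanceAs (FiniteDimensional ℝ (EuclideanSpace ℝ (Fin p)))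
  have hliz' : LinearIndependent ℝ fun i => X z (b (σ i)) := by
    simp only [chartRep_apply hz] at hliz
    exact LinearIndependent.of_comp (chartDeriv φ z).toLinearMap hliz
  have hle : Submodule.span ℝ (range fun i => X z (b (σ i))) ≤
      LinearMap.range (X z).toLinearMap := by
    rw [Submodule.span_le]
    rintro _ ⟨i, rfl⟩
    exact ⟨_, rfl⟩
  have := Submodule.finrank_mono hle
  rwa [finrank_span_eq_card hliz', Fintype.card_fin] at this

/-- The fields of a family commute everywhere as soon as they commute around the points near which
the rank is constant, since these points are dense. -/
theorem commuteAt_of_constant_rank (hX : ∀ v, SmoothField fun z => X z v)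
    (b : Module.Basis (Fin r) ℝ V)
    (h : ∀ (z₀ : M) (l : ℕ) (σ : Fin l → Fin r), (∀ᶠ z in 𝓝 z₀, familyRank X z = l) →
      LinearIndependent ℝ (fun i => X z₀ (b (σ i))) → ∀ᶠ z in 𝓝 z₀, CommuteAt X z) (z : M) :
    CommuteAt X z := by
  intro v w
  by_contra hne
  -- the bracket is nonzero on an open set around `z`
  obtain ⟨S, hS, hSo, hzS⟩ : ∃ S : Set M, (∀ y ∈ S,
      VectorField.mlieBracket (𝓡 p) (fun y => X y v) (fun y => X y w) y ≠ 0) ∧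
      IsOpen S ∧ z ∈ S := by
    refine eventually_nhds_iff.1 ?_
    set φ := chartAt (EuclideanSpace ℝ (Fin p)) z
    have hφ : φ ∈ IsManifold.maximalAtlas (𝓡 p) ∞ M := IsManifold.chart_mem_maximalAtlas z
    have hz : z ∈ φ.source := mem_chart_source _ z
    have hsm : ∀ v, ContDiffAt ℝ ∞ (chartRep φ fun y => X y v) (φ z) := fun v =>
      (contDiffOn_chartRep hφ (hX v)).contDiffAt (φ.open_target.mem_nhds (φ.map_source hz))
    have hcont : ContinuousAt (fun y => VectorField.lieBracket ℝ (chartRep φ fun y => X y v)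
        (chartRep φ fun y => X y w) (φ y)) z := by
      have h1 := ((hsm v).lieBracket_vectorField (m := 0) (hsm w) (by simp)).continuousAt
      exact h1.comp (φ.continuousAt hz)
    have hne' : VectorField.lieBracket ℝ (chartRep φ fun y => X y v)
        (chartRep φ fun y => X y w) (φ z) ≠ 0 := by
      rw [← chartDeriv_mlieBracket hφ (hX v) (hX w) hz]
      intro h0
      exact hne (chartDeriv_injective hφ hz (h0.trans (map_zero _).symm))
    filter_upwards [φ.open_source.mem_nhds hz, hcont.eventually_ne hne'] with y hy hy' h0
    rw [← chartDeriv_mlieBracket hφ (hX v) (hX w) hy, h0, map_zero] at hy'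
    exact hy' rfl
  -- at a point of this set with maximal rank the rank is locally constant
  have hbdd : ∀ y, familyRank X y ≤ p := fun y => by
    have : FiniteDimensional ℝ (TangentSpace (𝓡 p) y) :=
      inferInstanceAs (FiniteDimensional ℝ (EuclideanSpace ℝ (Fin p)))
    exact (Submodule.finrank_le _).trans_eq (finrank_euclideanSpace_fin (𝕜 := ℝ) (n := p))
  have hfin : (familyRank X '' S).Finite :=
    (finite_Iic p).subset (by rintro _ ⟨y, -, rfl⟩; exact hbdd y)
  obtain ⟨_, ⟨z₁, hz₁, rfl⟩, hmax⟩ := hfin.exists_maximal ⟨_, mem_image_of_mem _ hzS⟩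
  have hconst : ∀ᶠ y in 𝓝 z₁, familyRank X y = familyRank X z₁ := by
    filter_upwards [eventually_le_familyRank hX b z₁, hSo.mem_nhds hz₁] with y hy hyS
    exact le_antisymm (hmax (mem_image_of_mem _ hyS) hy) hy
  obtain ⟨σ, hσ⟩ := exists_linearIndependent_familyRank (X := X) b z₁
  exact hS z₁ hz₁ ((h z₁ _ σ hconst hσ).self_of_nhds v w)

end NormalForm

/-! ### Infinitesimal generators -/

section GeneratorFields

variable {s : ActionSide} {r p : ℕ}
  {G : Type*} [TopologicalSpace G] [ChartedSpace (EuclideanSpace ℝ (Fin r)) G] [Group G]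
  [LieGroup (𝓡 r) ∞ G]
  {M : Type*} [TopologicalSpace M] [ChartedSpace (EuclideanSpace ℝ (Fin p)) M]
  [IsManifold (𝓡 p) ∞ M]

omit [LieGroup (𝓡 r) ∞ G] [IsManifold (𝓡 p) ∞ M] in
/-- The differential of an action map at `(1, z)`. -/
theorem LieGroupAction.mfderiv_uncurry_one (a : LieGroupAction s r p G M) (z : M)
    (v : LieAlg r G) (w : TangentSpace (𝓡 p) z) :
    (mfderiv ((𝓡 r).prod (𝓡 p)) (𝓡 p) (fun q : G × M => a.act q.1 q.2) (1, z) (v, w) :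
      EuclideanSpace ℝ (Fin p)) = (a.generator z v + w : TangentSpace (𝓡 p) z) := by
  have hd := (a.smooth.contMDiffAt (x := ((1 : G), z))).mdifferentiableAt (by simp)
  have h := mfderiv_prod_eq_add_apply (v := ((v, w) : TangentSpace ((𝓡 r).prod (𝓡 p))
    ((1 : G), z))) hd
  have h1 : (fun z => a.act 1 z) = id := funext a.one_act
  have h2 : ∀ f : M → M, f = id → (mfderiv (𝓡 p) (𝓡 p) f z w : EuclideanSpace ℝ (Fin p)) = w := by
    rintro _ rfl
    rw [mfderiv_id]; rfl
  have h3 : ∀ x y e : EuclideanSpace ℝ (Fin p), x = y → e + x = e + y := by rintro _ _ _ rfl; rfl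
  exact h.trans (h3 _ _ (a.generator z v) (h2 _ h1))

/-- The generators are smooth vector fields: they are obtained from the tangent map of the action by
inserting `(v, 0)` at `(1, z)`. -/
theorem LieGroupAction.smoothField_generator (a : LieGroupAction s r p G M) (v : LieAlg r G) :
    SmoothField fun z => a.generator z v := by
  let f₁ : M → TangentBundle (𝓡 r) G := fun _ => ⟨1, v⟩
  let f₂ : M → TangentBundle (𝓡 p) M := fun z => ⟨z, 0⟩
  have h₁ : ContMDiff (𝓡 p) (𝓡 r).tangent ∞ f₁ := contMDiff_const
  have h₂ : ContMDiff (𝓡 p) (𝓡 p).tangent ∞ f₂ := Bundle.contMDiff_zeroSection _ _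
  let F₂ : TangentBundle (𝓡 r) G × TangentBundle (𝓡 p) M →
      TangentBundle ((𝓡 r).prod (𝓡 p)) (G × M) := (equivTangentBundleProd (𝓡 r) G (𝓡 p) M).symm
  have hF₂ : ContMDiff ((𝓡 r).tangent.prod (𝓡 p).tangent) ((𝓡 r).prod (𝓡 p)).tangent ∞ F₂ :=
    contMDiff_equivTangentBundleProd_symm
  have hF₃ := a.smooth.contMDiff_tangentMap (m := ∞) (by simp)
  have h := (hF₃.comp hF₂).comp (h₁.prodMk h₂)
  refine h.congr fun z => ?_
  have htr : ∀ (y : M) (w : EuclideanSpace ℝ (Fin p)), y = z →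
      (⟨z, w⟩ : TangentBundle (𝓡 p) M) = ⟨y, w⟩ := by rintro _ _ rfl; rfl
  refine (htr _ _ (a.one_act z)).trans (congrArg (Bundle.TotalSpace.mk _) ?_)
  have := a.mfderiv_uncurry_one z v 0
  rw [add_zero] at this
  exact this.symm

/-- Right multiplication of a Lie group on itself. -/
def rightMulAction (r : ℕ) (G : Type*) [TopologicalSpace G]
    [ChartedSpace (EuclideanSpace ℝ (Fin r)) G] [Group G] [LieGroup (𝓡 r) ∞ G] :
    LieGroupAction .right r r G G where
  act h g := g * h
  one_act := mul_one
  act_act h g z := mul_assoc z g h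
  smooth := contMDiff_snd.mul contMDiff_fst

/-- Left-invariant vector fields are smooth, being the generators of right multiplication. -/
theorem smoothField_mulInvariantVectorField (v : LieAlg r G) :
    SmoothField (mulInvariantVectorField (I := 𝓡 r) (G := G) v) :=
  (rightMulAction r G).smoothField_generator v

omit [IsManifold (𝓡 p) ∞ M] in
/-- The orbit maps of a right action relate left-invariant fields and generators. -/
theorem LieGroupAction.mfderiv_orbit_mulInvariant (a : LieGroupAction .right r p G M) (z : M)
    (v : LieAlg r G) (h : G) :
    mfderiv (𝓡 r) (𝓡 p) (fun g => a.act g z) h (mulInvariantVectorField v h) =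
      a.generator (a.act h z) v := by
  have hsm : ∀ z, ContMDiff (𝓡 r) (𝓡 p) ∞ fun g => a.act g z := fun z =>
    a.smooth.comp (contMDiff_id.prodMk contMDiff_const)
  have hd : MDifferentiableAt (𝓡 r) (𝓡 p) (fun g => a.act g z) (h * 1) :=
    (hsm z _).mdifferentiableAt (by simp)
  have hm : MDifferentiableAt (𝓡 r) (𝓡 r) (fun g => h * g) (1 : G) :=
    (contMDiff_mul_left (I := 𝓡 r) (n := ∞) (a := h)).mdifferentiableAt (by simp)
  have h1 := mfderiv_comp (1 : G) hd hm
  have h2 : (fun g => a.act g z) ∘ (fun g => h * g) = fun g => a.act g (a.act h z) := by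
    funext g
    exact (a.act_act g h z).symm
  rw [h2] at h1
  have h3 : ∀ y (w : EuclideanSpace ℝ (Fin r)), y = h →
      (mfderiv (𝓡 r) (𝓡 p) (fun g => a.act g z) y w : EuclideanSpace ℝ (Fin p)) =
        mfderiv (𝓡 r) (𝓡 p) (fun g => a.act g z) h w := by rintro _ _ rfl; rfl
  exact (h3 (h * 1) _ (mul_one h)).symm.trans (DFunLike.congr_fun h1 v).symm

/-- For right actions `[X(v), X(w)] = X([v, w])`. -/
theorem LieGroupAction.mlieBracket_generator_right (a : LieGroupAction .right r p G M)
    (v w : LieAlg r G) (z : M) :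
    VectorField.mlieBracket (𝓡 p) (fun y => a.generator y v) (fun y => a.generator y w) z =
      a.generator z ⁅v, w⁆ := by
  have hsm : ContMDiff (𝓡 r) (𝓡 p) ∞ fun g => a.act g z :=
    a.smooth.comp (contMDiff_id.prodMk contMDiff_const)
  have h := mfderiv_mlieBracket_of_related hsm
    (smoothField_mulInvariantVectorField v) (smoothField_mulInvariantVectorField w)
    (a.smoothField_generator v) (a.smoothField_generator w)
    (a.mfderiv_orbit_mulInvariant z v) (a.mfderiv_orbit_mulInvariant z w) 1
  have htr : ∀ y, y = z → (VectorField.mlieBracket (𝓡 p) (fun y => a.generator y v)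
      (fun y => a.generator y w) y : EuclideanSpace ℝ (Fin p)) =
      VectorField.mlieBracket (𝓡 p) (fun y => a.generator y v) (fun y => a.generator y w) z := by
    rintro _ rfl; rfl
  exact (htr _ (a.one_act z)).symm.trans h.symm

/-- The right action `(g, z) ↦ g⁻¹ · z` obtained from a left action. -/
def LieGroupAction.opposite (a : LieGroupAction .left r p G M) : LieGroupAction .right r p G M where
  act g z := a.act g⁻¹ z
  one_act z := by rw [inv_one, a.one_act]
  act_act h g z := by
    have := a.act_act h⁻¹ g⁻¹ z
    simpa [mul_inv_rev] using this
  smooth := a.smooth.comp ((contMDiff_fst.inv).prodMk contMDiff_snd)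

omit [IsManifold (𝓡 p) ∞ M] in
theorem LieGroupAction.generator_opposite (a : LieGroupAction .left r p G M) (z : M) :
    a.opposite.generator z = -a.generator z := by
  ext1 v
  have hsm : ContMDiff (𝓡 r) (𝓡 p) ∞ fun g => a.opposite.act g z :=
    a.opposite.smooth.comp (contMDiff_id.prodMk contMDiff_const)
  have hd : MDifferentiableAt (𝓡 r) (𝓡 p) (fun g => a.opposite.act g z) (1 : G) :=
    (hsm _).mdifferentiableAt (by simp)
  have hact := (a.smooth.contMDiffAt (x := ((1 : G), a.opposite.act 1 z))).mdifferentiableAt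
    (by simp)
  -- differentiate `g · (g⁻¹ · z) = z`
  have h1 := mfderiv_comp (I := 𝓡 r) (I' := (𝓡 r).prod (𝓡 p)) (I'' := 𝓡 p) (1 : G)
    (f := fun g => (g, a.opposite.act g z)) hact (mdifferentiableAt_id.prodMk hd)
  have h2 : (fun q : G × M => a.act q.1 q.2) ∘ (fun g => (g, a.opposite.act g z)) =
      fun _ => z := by
    funext g
    have := a.act_act g g⁻¹ z
    simpa [LieGroupAction.opposite, a.one_act] using this
  rw [h2, mfderiv_const] at h1
  have h3 : (0 : EuclideanSpace ℝ (Fin p)) = mfderiv ((𝓡 r).prod (𝓡 p)) (𝓡 p)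
      (fun q : G × M => a.act q.1 q.2) (1, a.opposite.act 1 z)
        (mfderiv (𝓡 r) ((𝓡 r).prod (𝓡 p)) (fun g => (g, a.opposite.act g z)) 1 v) :=
    DFunLike.congr_fun h1 v
  have hp : mfderiv (𝓡 r) ((𝓡 r).prod (𝓡 p)) (fun g => (g, a.opposite.act g z)) (1 : G) v =
      (v, mfderiv (𝓡 r) (𝓡 p) (fun g => a.opposite.act g z) 1 v) := by
    have h := mfderiv_prodMk (mdifferentiableAt_id (I := 𝓡 r) (x := (1 : G))) hd
    rw [mfderiv_id] at h
    exact DFunLike.congr_fun h v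
  rw [hp] at h3
  have h4 := h3.trans (a.mfderiv_uncurry_one (a.opposite.act 1 z) v
    (mfderiv (𝓡 r) (𝓡 p) (fun g => a.opposite.act g z) 1 v))
  have h5 : ∀ y (w : EuclideanSpace ℝ (Fin p)), y = z →
      (0 : EuclideanSpace ℝ (Fin p)) = (a.generator y v + (show TangentSpace (𝓡 p) y from w)) →
      (0 : EuclideanSpace ℝ (Fin p)) = (a.generator z v + (show TangentSpace (𝓡 p) z from w)) := by
    rintro _ _ rfl h; exact h
  exact (neg_eq_of_add_eq_zero_right (h5 _ _ (a.opposite.one_act z) h4).symm).symm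

/-- The generators with the sign of a right action, a homomorphism of Lie algebras from `𝔤` to the
vector fields on `M`. -/
def LieGroupAction.rightGenerator (a : LieGroupAction s r p G M) (z : M) :
    LieAlg r G →L[ℝ] TangentSpace (𝓡 p) z :=
  -s.sign • a.generator z

omit [IsManifold (𝓡 p) ∞ M] in
/-- Up to passing to the opposite action, every action may be taken to be a right action. -/
theorem LieGroupAction.exists_right (a : LieGroupAction s r p G M) :
    ∃ a' : LieGroupAction .right r p G M, a.rightGenerator = a'.generator := by
  cases s with
  | left =>
    refine ⟨a.opposite, ?_⟩
    funext z
    rw [a.generator_opposite]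
    simp [LieGroupAction.rightGenerator, ActionSide.sign]
  | right =>
    refine ⟨a, ?_⟩
    funext z
    simp [LieGroupAction.rightGenerator, ActionSide.sign]

theorem LieGroupAction.smoothField_rightGenerator (a : LieGroupAction s r p G M)
    (v : LieAlg r G) : SmoothField fun z => a.rightGenerator z v := by
  obtain ⟨a', h⟩ := a.exists_right
  rw [h]
  exact a'.smoothField_generator v

theorem LieGroupAction.mlieBracket_rightGenerator (a : LieGroupAction s r p G M)
    (v w : LieAlg r G) (z : M) :
    VectorField.mlieBracket (𝓡 p) (fun y => a.rightGenerator y v)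
      (fun y => a.rightGenerator y w) z = a.rightGenerator z ⁅v, w⁆ := by
  obtain ⟨a', h⟩ := a.exists_right
  rw [h]
  exact a'.mlieBracket_generator_right v w z

end GeneratorFields

/-! ### The Jacobiator of a bracket on a vector space -/

section Bivector

/-- The Jacobiator of the bracket `{A, B} = Λ (dA, dB)` of a bivector field `Λ` involves only the
first derivatives of the functions: the second derivatives, contracted with the Hamiltonian vectors
`H (dA) = Λ (dA, ·)`, cancel by symmetry. Differentiability of `Λ` at `q`, with derivative `Λ'`,
enters through the product rule `hΛ`. -/
theorem jacobiator_bivector {W : Type*} [NormedAddCommGroup W] [NormedSpace ℝ W] {q : W}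
    {Λ Λ' : W → (W →L[ℝ] ℝ) → (W →L[ℝ] ℝ) → ℝ}
    (hΛ : ∀ A B : W → W →L[ℝ] ℝ, DifferentiableAt ℝ A q → DifferentiableAt ℝ B q → ∀ v,
      fderiv ℝ (fun x => Λ x (A x) (B x)) q v =
        Λ' v (A q) (B q) + Λ q (fderiv ℝ A q v) (B q) + Λ q (A q) (fderiv ℝ B q v))
    (hskew : ∀ α β, Λ q α β = -Λ q β α) {H : (W →L[ℝ] ℝ) → W} (hH : ∀ α β, β (H α) = Λ q α β)
    {F K L : W → ℝ} (hF : ContDiffAt ℝ 2 F q) (hK : ContDiffAt ℝ 2 K q)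
    (hL : ContDiffAt ℝ 2 L q) :
    Λ q (fderiv ℝ F q) (fderiv ℝ (fun x => Λ x (fderiv ℝ K x) (fderiv ℝ L x)) q) +
      Λ q (fderiv ℝ K q) (fderiv ℝ (fun x => Λ x (fderiv ℝ L x) (fderiv ℝ F x)) q) +
      Λ q (fderiv ℝ L q) (fderiv ℝ (fun x => Λ x (fderiv ℝ F x) (fderiv ℝ K x)) q) =
    Λ' (H (fderiv ℝ F q)) (fderiv ℝ K q) (fderiv ℝ L q) +
      Λ' (H (fderiv ℝ K q)) (fderiv ℝ L q) (fderiv ℝ F q) +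
      Λ' (H (fderiv ℝ L q)) (fderiv ℝ F q) (fderiv ℝ K q) := by
  have hd : ∀ {A : W → ℝ}, ContDiffAt ℝ 2 A q → DifferentiableAt ℝ (fderiv ℝ A) q := fun hA =>
    (hA.fderiv_right (m := 1) (by norm_num)).differentiableAt (by norm_num)
  have hsymm : ∀ {A : W → ℝ}, ContDiffAt ℝ 2 A q → ∀ v w,
      fderiv ℝ (fderiv ℝ A) q v w = fderiv ℝ (fderiv ℝ A) q w v := fun hA v w =>
    (hA.isSymmSndFDerivAt (by rw [minSmoothness_of_isRCLikeNormedField])).eq v w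
  have key : ∀ {A B C : W → ℝ}, ContDiffAt ℝ 2 B q → ContDiffAt ℝ 2 C q →
      Λ q (fderiv ℝ A q) (fderiv ℝ (fun x => Λ x (fderiv ℝ B x) (fderiv ℝ C x)) q) =
        Λ' (H (fderiv ℝ A q)) (fderiv ℝ B q) (fderiv ℝ C q) -
        fderiv ℝ (fderiv ℝ B) q (H (fderiv ℝ A q)) (H (fderiv ℝ C q)) +
        fderiv ℝ (fderiv ℝ C) q (H (fderiv ℝ A q)) (H (fderiv ℝ B q)) := by
    intro A B C hB hC
    rw [← hH, hΛ _ _ (hd hB) (hd hC), hskew _ (fderiv ℝ C q), ← hH, ← hH]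
    ring
  rw [key hK hL, key hL hF, key hF hK, hsymm hK (H (fderiv ℝ F q)), hsymm hL (H (fderiv ℝ F q)),
    hsymm hF (H (fderiv ℝ L q))]
  ring

end Bivector

section SemidirectBivector

variable {E V V' : Type*} [NormedAddCommGroup E] [NormedSpace ℝ E] [NormedAddCommGroup V]
  [NormedSpace ℝ V] [NormedAddCommGroup V'] [NormedSpace ℝ V']

/-- The bivector on `E × V'` with mixed part given by the family `Y : V → 𝔛(E)` of vector fields and
Lie-Poisson part `c ξ [·, ·]`. Here `V'` stands for the dual of `V`, the pairing being `P`, and `D`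
sends a covector on `E × V'` to its component in `V`. -/
def semidirectBivector (P : V' →L[ℝ] V →L[ℝ] ℝ) (D : (E × V' →L[ℝ] ℝ) →L[ℝ] V) (Y : E → V →L[ℝ] E)
    (br : V →L[ℝ] V →L[ℝ] V) (c : ℝ) (q : E × V') (α β : E × V' →L[ℝ] ℝ) : ℝ :=
  β (Y q.1 (D α), 0) - α (Y q.1 (D β), 0) + c * P q.2 (br (D α) (D β))

variable {P : V' →L[ℝ] V →L[ℝ] ℝ} {D : (E × V' →L[ℝ] ℝ) →L[ℝ] V} {Y : E → V →L[ℝ] E}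
    {br : V →L[ℝ] V →L[ℝ] V} {c : ℝ}

theorem fderiv_semidirectBivector {q : E × V'} (hY : DifferentiableAt ℝ Y q.1)
    {A B : E × V' → E × V' →L[ℝ] ℝ} (hA : DifferentiableAt ℝ A q)
    (hB : DifferentiableAt ℝ B q) (v : E × V') :
    fderiv ℝ (fun x => semidirectBivector P D Y br c x (A x) (B x)) q v =
      (B q (fderiv ℝ Y q.1 v.1 (D (A q)), 0) - A q (fderiv ℝ Y q.1 v.1 (D (B q)), 0) +
        c * P v.2 (br (D (A q)) (D (B q)))) +
      semidirectBivector P D Y br c q (fderiv ℝ A q v) (B q) +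
      semidirectBivector P D Y br c q (A q) (fderiv ℝ B q v) := by
  have hY' := hY.hasFDerivAt.comp q (hasFDerivAt_fst (𝕜 := ℝ) (p := q))
  have hDA : HasFDerivAt (fun x => D (A x)) (D.comp (fderiv ℝ A q)) q :=
    D.hasFDerivAt.comp q hA.hasFDerivAt
  have hDB : HasFDerivAt (fun x => D (B x)) (D.comp (fderiv ℝ B q)) q :=
    D.hasFDerivAt.comp q hB.hasFDerivAt
  have h1 := hB.hasFDerivAt.clm_apply
    ((hY'.clm_apply hDA).prodMk (hasFDerivAt_const (0 : V') q))
  have h2 := hA.hasFDerivAt.clm_apply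
    ((hY'.clm_apply hDB).prodMk (hasFDerivAt_const (0 : V') q))
  have h3 := (P.hasFDerivAt.comp q (hasFDerivAt_snd (𝕜 := ℝ) (p := q))).clm_apply
    ((br.hasFDerivAt.comp q hDA).clm_apply hDB)
  have h := (h1.sub h2).add (h3.const_mul c)
  have hadd : ∀ (α : E × V' →L[ℝ] ℝ) (x y : E), α (x + y, 0) = α (x, 0) + α (y, 0) :=
    fun α x y => by rw [← map_add, Prod.mk_add_mk, add_zero]
  refine (DFunLike.congr_fun h.fderiv v).trans ?_
  simp [semidirectBivector, hadd]
  ring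

theorem contDiffAt_semidirectBivector {q : E × V'} {n : WithTop ℕ∞}
    (hY : ContDiffAt ℝ n Y q.1)
    {A B : E × V' → E × V' →L[ℝ] ℝ} (hA : ContDiffAt ℝ n A q)
    (hB : ContDiffAt ℝ n B q) :
    ContDiffAt ℝ n (fun x => semidirectBivector P D Y br c x (A x) (B x)) q := by
  have hY' := hY.comp q contDiffAt_fst
  have hDA := D.contDiff.contDiffAt.comp q hA
  have hDB := D.contDiff.contDiffAt.comp q hB
  exact ((hB.clm_apply ((hY'.clm_apply hDA).prodMk contDiffAt_const)).sub
    (hA.clm_apply ((hY'.clm_apply hDB).prodMk contDiffAt_const))).add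
    (contDiffAt_const.mul ((P.contDiff.contDiffAt.comp q contDiffAt_snd).clm_apply
      ((br.contDiff.contDiffAt.comp q hDA).clm_apply hDB)))

theorem semidirectBivector_linear_left (q : E × V') (a b : ℝ) (α β γ : E × V' →L[ℝ] ℝ) :
    semidirectBivector P D Y br c q (a • α + b • β) γ =
      a * semidirectBivector P D Y br c q α γ + b * semidirectBivector P D Y br c q β γ := by
  let i : E →L[ℝ] E × V' := ContinuousLinearMap.inl ℝ E V'
  have hi : ∀ x : E, (x, (0 : V')) = i x := fun x => rfl
  simp only [semidirectBivector, hi, map_add, map_smul, add_apply, smul_apply, smul_eq_mul]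
  ring

theorem semidirectBivector_skew (hskew : ∀ k l, br k l = -br l k) (q : E × V')
    (α β : E × V' →L[ℝ] ℝ) :
    semidirectBivector P D Y br c q α β = -semidirectBivector P D Y br c q β α := by
  simp only [semidirectBivector, hskew (D α) (D β), map_neg]
  ring

theorem semidirectBivector_linear_right (hskew : ∀ k l, br k l = -br l k) (q : E × V') (a b : ℝ)
    (α β γ : E × V' →L[ℝ] ℝ) :
    semidirectBivector P D Y br c q γ (a • α + b • β) =
      a * semidirectBivector P D Y br c q γ α + b * semidirectBivector P D Y br c q γ β := by
  rw [semidirectBivector_skew hskew, semidirectBivector_linear_left,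
    semidirectBivector_skew hskew _ γ α, semidirectBivector_skew hskew _ γ β]
  ring

/-- The Jacobiator of the bracket on `E × V'` measures the failure `N` of `Y : V → 𝔛(E)` to satisfy
`[Y k, Y l] = c Y [k, l]`: all other terms cancel by the Jacobi identity of `br`. -/
theorem jacobiator_semidirectBivector
    (hD : ∀ (α : E × V' →L[ℝ] ℝ) (ν : V'), P ν (D α) = α (0, ν))
    (hP : Function.Surjective P)
    (hskew : ∀ k l, br k l = -br l k)
    (hjac : ∀ k l m, br k (br l m) + br l (br m k) + br m (br k l) = 0)
    {q : E × V'} (hY : DifferentiableAt ℝ Y q.1) {F K L : E × V' → ℝ}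
    (hF : ContDiffAt ℝ 2 F q) (hK : ContDiffAt ℝ 2 K q) (hL : ContDiffAt ℝ 2 L q) {N : V → V → E}
    (hN : ∀ k l, N k l = fderiv ℝ Y q.1 (Y q.1 k) l - fderiv ℝ Y q.1 (Y q.1 l) k -
      c • Y q.1 (br k l)) :
    semidirectBivector P D Y br c q (fderiv ℝ F q) (fderiv ℝ (fun x =>
        semidirectBivector P D Y br c x (fderiv ℝ K x) (fderiv ℝ L x)) q) +
      semidirectBivector P D Y br c q (fderiv ℝ K q) (fderiv ℝ (fun x =>
        semidirectBivector P D Y br c x (fderiv ℝ L x) (fderiv ℝ F x)) q) +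
      semidirectBivector P D Y br c q (fderiv ℝ L q) (fderiv ℝ (fun x =>
        semidirectBivector P D Y br c x (fderiv ℝ F x) (fderiv ℝ K x)) q) =
    fderiv ℝ F q (N (D (fderiv ℝ K q)) (D (fderiv ℝ L q)), 0) +
      fderiv ℝ K q (N (D (fderiv ℝ L q)) (D (fderiv ℝ F q)), 0) +
      fderiv ℝ L q (N (D (fderiv ℝ F q)) (D (fderiv ℝ K q)), 0) := by
  let i : E →L[ℝ] E × V' := ContinuousLinearMap.inl ℝ E V'
  have hi : ∀ x : E, (x, (0 : V')) = i x := fun x => rfl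
  obtain ⟨R, hR⟩ := hP.hasRightInverse
  -- the Hamiltonian vector of a covector `α`, with `R` a right inverse of the pairing `P`
  let H : (E × V' →L[ℝ] ℝ) → E × V' := fun α =>
    (Y q.1 (D α), R (-(α.comp (i.comp (Y q.1))) + c • (P q.2).comp (br (D α))))
  have h := jacobiator_bivector
    (Λ := semidirectBivector P D Y br c) (Λ' := fun v α β =>
      β (fderiv ℝ Y q.1 v.1 (D α), 0) - α (fderiv ℝ Y q.1 v.1 (D β), 0) +
        c * P v.2 (br (D α) (D β)))
    (H := H) (fun A B hA hB v => fderiv_semidirectBivector hY hA hB v) ?_ ?_ hF hK hL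
  · rw [h]
    have h0 : P q.2 (br (D (fderiv ℝ F q)) (br (D (fderiv ℝ K q)) (D (fderiv ℝ L q)))) +
        P q.2 (br (D (fderiv ℝ K q)) (br (D (fderiv ℝ L q)) (D (fderiv ℝ F q)))) +
        P q.2 (br (D (fderiv ℝ L q)) (br (D (fderiv ℝ F q)) (D (fderiv ℝ K q)))) = 0 := by
      rw [← map_add, ← map_add, hjac, map_zero]
    simp only [hN, hi, map_sub, map_smul, H, hR _, add_apply, neg_apply, smul_apply, smul_eq_mul,
      ContinuousLinearMap.comp_apply]
    -- the terms `c ξ [·, [·, ·]]` of the Hamiltonian vectors cancel by the Jacobi identity of `br`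
    linear_combination c ^ 2 * h0
  · exact semidirectBivector_skew hskew q
  · intro α β
    have h1 : H α = (Y q.1 (D α), 0) + (0, (H α).2) := by simp [H]
    rw [h1, map_add, ← hD]
    simp only [semidirectBivector, H, hR _, add_apply, neg_apply, smul_apply, smul_eq_mul, hi,
      ContinuousLinearMap.comp_apply]
    ring

end SemidirectBivector

section CoGrad

variable {p r : ℕ}

/-- The component in `𝔤` of a covector on `E × 𝔤*`. -/
def coGrad (p r : ℕ) : (EuclideanSpace ℝ (Fin p) × LieCoalg r →L[ℝ] ℝ) →L[ℝ]
    EuclideanSpace ℝ (Fin r) :=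
  ∑ i : Fin r, (ContinuousLinearMap.apply ℝ ℝ
    ((0 : EuclideanSpace ℝ (Fin p)), (EuclideanSpace.proj i : LieCoalg r))).smulRight
      (EuclideanSpace.single i (1 : ℝ))

theorem coGrad_apply (α : EuclideanSpace ℝ (Fin p) × LieCoalg r →L[ℝ] ℝ) :
    coGrad p r α = ∑ i : Fin r, α (0, EuclideanSpace.proj i) • EuclideanSpace.single i (1 : ℝ) := by
  simp [coGrad]

theorem apply_coGrad (α : EuclideanSpace ℝ (Fin p) × LieCoalg r →L[ℝ] ℝ) (ν : LieCoalg r) :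
    ν (coGrad p r α) = α (0, ν) := by
  let β : LieCoalg r →L[ℝ] ℝ := α.comp (ContinuousLinearMap.inr ℝ _ _)
  have h1 : fderiv ℝ β 0 = β := β.fderiv
  have h := apply_coalgGrad β 0 ν
  rw [h1] at h
  rw [coGrad_apply]
  unfold coalgGrad at h
  rw [h1] at h
  exact h

theorem coalgGrad_eval (v : EuclideanSpace ℝ (Fin r)) (ξ : LieCoalg r) :
    coalgGrad (fun ξ => ξ v) ξ = v := by
  have h : ∀ ν : LieCoalg r, ν (coalgGrad (fun ξ => ξ v) ξ) = ν v := fun ν => by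
    rw [apply_coalgGrad]
    exact DFunLike.congr_fun (ContinuousLinearMap.apply ℝ ℝ v).fderiv ν
  ext i
  exact h (EuclideanSpace.proj i)

end CoGrad

/-! ### Local expressions of brackets on `C^∞(M × 𝔤*)` -/

section FamilyBracket

variable {r p : ℕ}
  {G : Type*} [TopologicalSpace G] [ChartedSpace (EuclideanSpace ℝ (Fin r)) G] [Group G]
  {M : Type*} [TopologicalSpace M] [ChartedSpace (EuclideanSpace ℝ (Fin p)) M]

/-- The differential in the direction of `M` of a function on `M × 𝔤*`. -/
def baseDeriv (F : M × LieCoalg r → ℝ) (z : M) (ξ : LieCoalg r) : TangentSpace (𝓡 p) z →L[ℝ] ℝ :=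
  mfderiv (𝓡 p) 𝓘(ℝ, ℝ) (fun z => F (z, ξ)) z

/-- The bracket on `C^∞(M × 𝔤*)` whose mixed part is given by a family `Y : 𝔤 → 𝔛(M)` of vector
fields and whose Lie-Poisson part is multiplied by `c`, so that such brackets can be added. -/
def familyBracket (Y : ∀ z : M, LieAlg r G →L[ℝ] TangentSpace (𝓡 p) z) (c : ℝ)
    (F K : M × LieCoalg r → ℝ) : M × LieCoalg r → ℝ := fun q =>
  let δF : LieAlg r G := coalgGrad (fun ξ => F (q.1, ξ)) q.2
  let δK : LieAlg r G := coalgGrad (fun ξ => K (q.1, ξ)) q.2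
  let br : LieAlg r G := ⁅δF, δK⁆
  baseDeriv K q.1 q.2 (Y q.1 δF) - baseDeriv F q.1 q.2 (Y q.1 δK) + c * q.2 br

/-- Expressed by generators of right type, the sign `ε` of the bracket disappears. -/
theorem LieGroupAction.poissonBracket_eq_familyBracket {s : ActionSide}
    (a : LieGroupAction s r p G M) :
    a.poissonBracket = familyBracket a.rightGenerator 1 := by
  funext F K q
  have key : ∀ (A B : TangentSpace (𝓡 p) q.1 →L[ℝ] ℝ) (u v : LieAlg r G) (e : ℝ),
      s.sign * (A (a.generator q.1 v) - B (a.generator q.1 u)) + e =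
        B (a.rightGenerator q.1 u) - A (a.rightGenerator q.1 v) + 1 * e := fun A B u v e => by
    simp only [LieGroupAction.rightGenerator, smul_apply, map_smul, smul_eq_mul]
    ring
  exact key _ _ _ _ _

theorem familyBracket_add (Y₁ Y₂ : ∀ z : M, LieAlg r G →L[ℝ] TangentSpace (𝓡 p) z) (c₁ c₂ : ℝ)
    (F K : M × LieCoalg r → ℝ) :
    familyBracket Y₁ c₁ F K + familyBracket Y₂ c₂ F K =
      familyBracket (fun z => Y₁ z + Y₂ z) (c₁ + c₂) F K := by
  funext q
  have key : ∀ (A B : TangentSpace (𝓡 p) q.1 →L[ℝ] ℝ) (u v : LieAlg r G) (e : ℝ),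
      B (Y₁ q.1 u) - A (Y₁ q.1 v) + c₁ * e + (B (Y₂ q.1 u) - A (Y₂ q.1 v) + c₂ * e) =
        B ((Y₁ q.1 + Y₂ q.1) u) - A ((Y₁ q.1 + Y₂ q.1) v) + (c₁ + c₂) * e := fun A B u v e => by
    simp only [add_apply, map_add]
    ring
  exact key _ _ _ _ _

/-- The bracket of `𝔤 = T_e G = ℝ^r` as a continuous bilinear map. -/
def lieBracketCLM (r : ℕ) (G : Type*) [TopologicalSpace G]
    [ChartedSpace (EuclideanSpace ℝ (Fin r)) G] [Group G] [LieGroup (𝓡 r) ∞ G] :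
    EuclideanSpace ℝ (Fin r) →L[ℝ] EuclideanSpace ℝ (Fin r) →L[ℝ] EuclideanSpace ℝ (Fin r) :=
  haveI : LieGroup (𝓡 r) (minSmoothness ℝ 3) G := by
    rw [minSmoothness_of_isRCLikeNormedField]; infer_instance
  LinearMap.toContinuousLinearMap
    ((LinearMap.toContinuousLinearMap (𝕜 := ℝ) (E := EuclideanSpace ℝ (Fin r))
      (F' := EuclideanSpace ℝ (Fin r))).toLinearMap ∘ₗ
    (LinearMap.mk₂ ℝ (fun v w : LieAlg r G => ⁅v, w⁆) add_lie smul_lie lie_add lie_smul :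
      LieAlg r G →ₗ[ℝ] LieAlg r G →ₗ[ℝ] LieAlg r G))

theorem lieBracketCLM_skew [LieGroup (𝓡 r) ∞ G] (v w : EuclideanSpace ℝ (Fin r)) :
    lieBracketCLM r G v w = -lieBracketCLM r G w v := by
  have : LieGroup (𝓡 r) (minSmoothness ℝ 3) G := by
    rw [minSmoothness_of_isRCLikeNormedField]; infer_instance
  have h : ∀ v w : LieAlg r G, ⁅v, w⁆ = -⁅w, v⁆ := fun v w => (lie_skew v w).symm
  exact h v w

theorem lieBracketCLM_jacobi [LieGroup (𝓡 r) ∞ G] (u v w : EuclideanSpace ℝ (Fin r)) :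
    lieBracketCLM r G u (lieBracketCLM r G v w) + lieBracketCLM r G v (lieBracketCLM r G w u) +
      lieBracketCLM r G w (lieBracketCLM r G u v) = 0 := by
  have : LieGroup (𝓡 r) (minSmoothness ℝ 3) G := by
    rw [minSmoothness_of_isRCLikeNormedField]; infer_instance
  have h : ∀ u v w : LieAlg r G, ⁅u, ⁅v, w⁆⁆ + ⁅v, ⁅w, u⁆⁆ + ⁅w, ⁅u, v⁆⁆ = 0 := lie_jacobi
  exact h u v w

/-- The local expression of a function on `M × 𝔤*` in a chart of `M`. -/
def chartFun (φ : OpenPartialHomeomorph M (EuclideanSpace ℝ (Fin p))) (F : M × LieCoalg r → ℝ)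
    (q : EuclideanSpace ℝ (Fin p) × LieCoalg r) : ℝ :=
  F (φ.symm q.1, q.2)

/-- The local expression of a family of vector fields in a chart of `M`. -/
def chartFamily (φ : OpenPartialHomeomorph M (EuclideanSpace ℝ (Fin p)))
    (Y : ∀ z : M, LieAlg r G →L[ℝ] TangentSpace (𝓡 p) z) (x : EuclideanSpace ℝ (Fin p)) :
    EuclideanSpace ℝ (Fin r) →L[ℝ] EuclideanSpace ℝ (Fin p) :=
  (chartDeriv φ (φ.symm x)).comp (Y (φ.symm x))

variable {φ : OpenPartialHomeomorph M (EuclideanSpace ℝ (Fin p))}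
  (hφ : φ ∈ IsManifold.maximalAtlas (𝓡 p) ∞ M)
  {Y : ∀ z : M, LieAlg r G →L[ℝ] TangentSpace (𝓡 p) z} {c : ℝ}
  {F K L : M × LieCoalg r → ℝ}

include hφ

theorem contDiffOn_chartFamily [IsManifold (𝓡 p) ∞ M] (hY : ∀ v, SmoothField fun z => Y z v) :
    ContDiffOn ℝ ∞ (chartFamily φ Y) φ.target :=
  contDiffOn_clm_apply.2 fun v => contDiffOn_chartRep hφ (hY v)

theorem contDiffAt_chartFun (hF : ContMDiff ((𝓡 p).prod 𝓘(ℝ, LieCoalg r)) 𝓘(ℝ, ℝ) ∞ F)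
    {q : EuclideanSpace ℝ (Fin p) × LieCoalg r} (hq : q.1 ∈ φ.target) :
    ContDiffAt ℝ ∞ (chartFun φ F) q := by
  rw [← contMDiffAt_iff_contDiffAt]
  have h1 : ContMDiffAt 𝓘(ℝ, EuclideanSpace ℝ (Fin p) × LieCoalg r) (𝓡 p) ∞
      (fun q : EuclideanSpace ℝ (Fin p) × LieCoalg r => φ.symm q.1) q :=
    (contMDiffAt_symm_of_mem_maximalAtlas hφ hq).comp q
      (contMDiffAt_iff_contDiffAt.2 contDiffAt_fst)
  have h2 : ContMDiffAt 𝓘(ℝ, EuclideanSpace ℝ (Fin p) × LieCoalg r) 𝓘(ℝ, LieCoalg r) ∞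
      (fun q : EuclideanSpace ℝ (Fin p) × LieCoalg r => q.2) q :=
    contMDiffAt_iff_contDiffAt.2 contDiffAt_snd
  exact (hF _).comp q (h1.prodMk h2)

theorem hasFDerivAt_chartFun (hF : ContMDiff ((𝓡 p).prod 𝓘(ℝ, LieCoalg r)) 𝓘(ℝ, ℝ) ∞ F) {z : M}
    (hz : z ∈ φ.source) (ξ : LieCoalg r) :
    HasFDerivAt (chartFun φ F) (fderiv ℝ (chartFun φ F) (φ z, ξ)) (φ z, ξ) :=
  ((contDiffAt_chartFun hφ hF (q := (φ z, ξ)) (φ.map_source hz)).differentiableAt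
    (by simp)).hasFDerivAt

theorem fderiv_chartFun_inr (hF : ContMDiff ((𝓡 p).prod 𝓘(ℝ, LieCoalg r)) 𝓘(ℝ, ℝ) ∞ F)
    {z : M} (hz : z ∈ φ.source) (ξ ν : LieCoalg r) :
    fderiv ℝ (chartFun φ F) (φ z, ξ) (0, ν) = fderiv ℝ (fun ξ => F (z, ξ)) ξ ν := by
  have h1 : (fun ξ => F (z, ξ)) = chartFun φ F ∘ fun ξ => (φ z, ξ) := by
    funext ξ
    simp [chartFun, φ.left_inv hz]
  have h2 : HasFDerivAt (fun ξ : LieCoalg r => (φ z, ξ)) _ ξ :=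
    (hasFDerivAt_const (𝕜 := ℝ) (φ z) ξ).prodMk (hasFDerivAt_id (𝕜 := ℝ) ξ)
  have h3 := (hasFDerivAt_chartFun hφ hF hz ξ).comp ξ h2
  rw [h1, h3.fderiv]
  rfl

theorem fderiv_chartFun_inl (hF : ContMDiff ((𝓡 p).prod 𝓘(ℝ, LieCoalg r)) 𝓘(ℝ, ℝ) ∞ F)
    {z : M} (hz : z ∈ φ.source) (ξ : LieCoalg r) (w : TangentSpace (𝓡 p) z) :
    fderiv ℝ (chartFun φ F) (φ z, ξ) (chartDeriv φ z w, 0) =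
      baseDeriv F z ξ w := by
  have h1 : (fun z => F (z, ξ)) =ᶠ[𝓝 z] (fun x => chartFun φ F (x, ξ)) ∘ φ := by
    filter_upwards [φ.open_source.mem_nhds hz] with y hy
    simp [chartFun, φ.left_inv hy]
  have h2 : HasFDerivAt (fun x : EuclideanSpace ℝ (Fin p) => (x, ξ)) _ (φ z) :=
    (hasFDerivAt_id (𝕜 := ℝ) (φ z)).prodMk (hasFDerivAt_const (𝕜 := ℝ) ξ (φ z))
  have h3 := (hasFDerivAt_chartFun hφ hF hz ξ).comp (φ z) h2
  have h4 : MDifferentiableAt (𝓡 p) 𝓘(ℝ, ℝ) (fun x => chartFun φ F (x, ξ)) (φ z) :=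
    h3.differentiableAt.mdifferentiableAt
  have h5 := mfderiv_comp z h4 ((mdifferentiable_of_mem_maximalAtlas hφ).mdifferentiableAt hz)
  rw [← h1.mfderiv_eq, mfderiv_eq_fderiv] at h5
  have h6 := DFunLike.congr_fun h3.fderiv (chartDeriv φ z w)
  exact ((DFunLike.congr_fun h5 w).trans h6).symm

theorem coGrad_fderiv_chartFun (hF : ContMDiff ((𝓡 p).prod 𝓘(ℝ, LieCoalg r)) 𝓘(ℝ, ℝ) ∞ F)
    {z : M} (hz : z ∈ φ.source) (ξ : LieCoalg r) :
    coGrad p r (fderiv ℝ (chartFun φ F) (φ z, ξ)) = coalgGrad (fun ξ => F (z, ξ)) ξ := by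
  rw [coGrad_apply, coalgGrad]
  simp only [fderiv_chartFun_inr hφ hF hz]

/-- In a chart of `M`, the bracket is that of a bivector field on `ℝ^p × 𝔤*`. -/
theorem familyBracket_eq_semidirectBivector [LieGroup (𝓡 r) ∞ G]
    (hF : ContMDiff ((𝓡 p).prod 𝓘(ℝ, LieCoalg r)) 𝓘(ℝ, ℝ) ∞ F)
    (hK : ContMDiff ((𝓡 p).prod 𝓘(ℝ, LieCoalg r)) 𝓘(ℝ, ℝ) ∞ K)
    {z : M} (hz : z ∈ φ.source) (ξ : LieCoalg r) :
    familyBracket Y c F K (z, ξ) =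
      semidirectBivector (ContinuousLinearMap.id ℝ (LieCoalg r)) (coGrad p r) (chartFamily φ Y)
        (lieBracketCLM r G) c (φ z, ξ) (fderiv ℝ (chartFun φ F) (φ z, ξ))
        (fderiv ℝ (chartFun φ K) (φ z, ξ)) := by
  have h : ∀ v : EuclideanSpace ℝ (Fin r),
      chartFamily φ Y (φ z) v = chartDeriv φ z (Y z v) :=
    fun v => chartRep_apply (V := fun z => Y z v) hz
  simp only [semidirectBivector]
  rw [coGrad_fderiv_chartFun hφ hF hz, coGrad_fderiv_chartFun hφ hK hz, h, h,
    fderiv_chartFun_inl hφ hF hz, fderiv_chartFun_inl hφ hK hz]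
  rfl

end FamilyBracket

/-! ### The Jacobiator of a bracket on `C^∞(M × 𝔤*)` -/

section PoissonFamily

variable {r p : ℕ}
  {G : Type*} [TopologicalSpace G] [ChartedSpace (EuclideanSpace ℝ (Fin r)) G] [Group G]
  [LieGroup (𝓡 r) ∞ G]
  {M : Type*} [TopologicalSpace M] [ChartedSpace (EuclideanSpace ℝ (Fin p)) M]
  [IsManifold (𝓡 p) ∞ M]
  {Y : ∀ z : M, LieAlg r G →L[ℝ] TangentSpace (𝓡 p) z} {c : ℝ}
  {F K L : M × LieCoalg r → ℝ}

omit [IsManifold (𝓡 p) ∞ M] in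
theorem chartFun_familyBracket_eventuallyEq
    {φ : OpenPartialHomeomorph M (EuclideanSpace ℝ (Fin p))}
    (hφ : φ ∈ IsManifold.maximalAtlas (𝓡 p) ∞ M)
    (hF : ContMDiff ((𝓡 p).prod 𝓘(ℝ, LieCoalg r)) 𝓘(ℝ, ℝ) ∞ F)
    (hK : ContMDiff ((𝓡 p).prod 𝓘(ℝ, LieCoalg r)) 𝓘(ℝ, ℝ) ∞ K)
    {q : EuclideanSpace ℝ (Fin p) × LieCoalg r} (hq : q.1 ∈ φ.target) :
    chartFun φ (familyBracket Y c F K) =ᶠ[𝓝 q] fun x =>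
      semidirectBivector (ContinuousLinearMap.id ℝ (LieCoalg r)) (coGrad p r) (chartFamily φ Y)
        (lieBracketCLM r G) c x (fderiv ℝ (chartFun φ F) x) (fderiv ℝ (chartFun φ K) x) := by
  filter_upwards [(φ.open_target.preimage continuous_fst).mem_nhds hq] with x hx
  have h := familyBracket_eq_semidirectBivector (Y := Y) (c := c) hφ hF hK (φ.map_target hx) x.2
  rw [φ.right_inv hx] at h
  exact h

theorem contMDiff_familyBracket (hY : ∀ v, SmoothField fun z => Y z v)
    (hF : ContMDiff ((𝓡 p).prod 𝓘(ℝ, LieCoalg r)) 𝓘(ℝ, ℝ) ∞ F)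
    (hK : ContMDiff ((𝓡 p).prod 𝓘(ℝ, LieCoalg r)) 𝓘(ℝ, ℝ) ∞ K) :
    ContMDiff ((𝓡 p).prod 𝓘(ℝ, LieCoalg r)) 𝓘(ℝ, ℝ) ∞ (familyBracket Y c F K) := by
  rintro ⟨z, ξ⟩
  let φ := chartAt (EuclideanSpace ℝ (Fin p)) z
  have hφ : φ ∈ IsManifold.maximalAtlas (𝓡 p) ∞ M := IsManifold.chart_mem_maximalAtlas z
  have hz : z ∈ φ.source := mem_chart_source _ z
  have hx := φ.map_source hz
  have h1 : ContDiffAt ℝ ∞ (chartFun φ (familyBracket Y c F K)) (φ z, ξ) := by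
    refine ContDiffAt.congr_of_eventuallyEq ?_
      (chartFun_familyBracket_eventuallyEq hφ hF hK (q := (φ z, ξ)) hx)
    exact contDiffAt_semidirectBivector
      ((contDiffOn_chartFamily hφ hY).contDiffAt (φ.open_target.mem_nhds hx))
      ((contDiffAt_chartFun hφ hF (q := (φ z, ξ)) hx).fderiv_right (by simp))
      ((contDiffAt_chartFun hφ hK (q := (φ z, ξ)) hx).fderiv_right (by simp))
  have h2 : ContMDiffAt ((𝓡 p).prod 𝓘(ℝ, LieCoalg r))
      𝓘(ℝ, EuclideanSpace ℝ (Fin p) × LieCoalg r) ∞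
      (fun q : M × LieCoalg r => (φ q.1, q.2)) (z, ξ) :=
    ((contMDiffAt_of_mem_maximalAtlas hφ hz).comp (z, ξ) contMDiffAt_fst).prodMk_space
      contMDiffAt_snd
  refine ((contMDiffAt_iff_contDiffAt.2 h1).comp (z, ξ) h2).congr_of_eventuallyEq ?_
  filter_upwards [(φ.open_source.preimage continuous_fst).mem_nhds hz] with q hq
  exact congrArg (fun y => familyBracket Y c F K (y, q.2)) (φ.left_inv hq).symm

/-- The local expression of the failure of `Y` to be a homomorphism up to the factor `c`. -/
theorem chartDeriv_mlieBracket_sub {φ : OpenPartialHomeomorph M (EuclideanSpace ℝ (Fin p))}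
    (hφ : φ ∈ IsManifold.maximalAtlas (𝓡 p) ∞ M) (hY : ∀ v, SmoothField fun z => Y z v) {z : M}
    (hz : z ∈ φ.source) (v w : LieAlg r G) :
    chartDeriv φ z (VectorField.mlieBracket (𝓡 p) (fun y => Y y v) (fun y => Y y w) z -
        c • Y z ⁅v, w⁆) =
      fderiv ℝ (chartFamily φ Y) (φ z) (chartFamily φ Y (φ z) v) w -
        fderiv ℝ (chartFamily φ Y) (φ z) (chartFamily φ Y (φ z) w) v -
        c • chartFamily φ Y (φ z) (lieBracketCLM r G v w) := by
  have hYd : DifferentiableAt ℝ (chartFamily φ Y) (φ z) :=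
    ((contDiffOn_chartFamily hφ hY).contDiffAt
      (φ.open_target.mem_nhds (φ.map_source hz))).differentiableAt (by simp)
  have hf : ∀ (v : EuclideanSpace ℝ (Fin r)) (h : EuclideanSpace ℝ (Fin p)),
      fderiv ℝ (chartRep φ fun y => Y y v) (φ z) h = fderiv ℝ (chartFamily φ Y) (φ z) h v :=
    fun v h => DFunLike.congr_fun ((ContinuousLinearMap.apply ℝ (EuclideanSpace ℝ (Fin p))
      v).hasFDerivAt.comp (φ z) hYd.hasFDerivAt).fderiv h
  rw [map_sub, map_smul, chartDeriv_mlieBracket hφ (hY v) (hY w) hz, VectorField.lieBracket_eq]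
  refine congrArg₂ _ (congrArg₂ _ (hf _ _) (hf _ _)) (congrArg _ ?_)
  exact (chartRep_apply (V := fun y => Y y ⁅v, w⁆) hz).symm

theorem familyBracket_familyBracket_eq {φ : OpenPartialHomeomorph M (EuclideanSpace ℝ (Fin p))}
    (hφ : φ ∈ IsManifold.maximalAtlas (𝓡 p) ∞ M) (hY : ∀ v, SmoothField fun z => Y z v)
    (hF : ContMDiff ((𝓡 p).prod 𝓘(ℝ, LieCoalg r)) 𝓘(ℝ, ℝ) ∞ F)
    (hK : ContMDiff ((𝓡 p).prod 𝓘(ℝ, LieCoalg r)) 𝓘(ℝ, ℝ) ∞ K)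
    (hL : ContMDiff ((𝓡 p).prod 𝓘(ℝ, LieCoalg r)) 𝓘(ℝ, ℝ) ∞ L)
    {z : M} (hz : z ∈ φ.source) (ξ : LieCoalg r) :
    familyBracket Y c F (familyBracket Y c K L) (z, ξ) =
      semidirectBivector (ContinuousLinearMap.id ℝ (LieCoalg r)) (coGrad p r)
        (chartFamily φ Y) (lieBracketCLM r G) c (φ z, ξ) (fderiv ℝ (chartFun φ F) (φ z, ξ))
        (fderiv ℝ (fun x => semidirectBivector (ContinuousLinearMap.id ℝ (LieCoalg r))
          (coGrad p r) (chartFamily φ Y) (lieBracketCLM r G) c x (fderiv ℝ (chartFun φ K) x)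
          (fderiv ℝ (chartFun φ L) x)) (φ z, ξ)) := by
  rw [familyBracket_eq_semidirectBivector hφ hF (contMDiff_familyBracket hY hK hL) hz,
    (chartFun_familyBracket_eventuallyEq hφ hK hL (q := (φ z, ξ)) (φ.map_source hz)).fderiv_eq]

/-- The Jacobiator is the sum over cyclic permutations of `d_z F (N (δK, δL))`, where `N` is the
failure of `Y` to satisfy `[Y v, Y w] = c Y [v, w]`. -/
theorem jacobiator_familyBracket (hY : ∀ v, SmoothField fun z => Y z v)
    (hF : ContMDiff ((𝓡 p).prod 𝓘(ℝ, LieCoalg r)) 𝓘(ℝ, ℝ) ∞ F)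
    (hK : ContMDiff ((𝓡 p).prod 𝓘(ℝ, LieCoalg r)) 𝓘(ℝ, ℝ) ∞ K)
    (hL : ContMDiff ((𝓡 p).prod 𝓘(ℝ, LieCoalg r)) 𝓘(ℝ, ℝ) ∞ L) (z : M) (ξ : LieCoalg r)
    {N : LieAlg r G → LieAlg r G → TangentSpace (𝓡 p) z}
    (hN : ∀ v w, N v w = VectorField.mlieBracket (𝓡 p) (fun y => Y y v) (fun y => Y y w) z -
      c • Y z ⁅v, w⁆) :
    familyBracket Y c F (familyBracket Y c K L) (z, ξ) +
      familyBracket Y c K (familyBracket Y c L F) (z, ξ) +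
      familyBracket Y c L (familyBracket Y c F K) (z, ξ) =
    baseDeriv F z ξ (N (coalgGrad (fun ξ => K (z, ξ)) ξ) (coalgGrad (fun ξ => L (z, ξ)) ξ)) +
      baseDeriv K z ξ (N (coalgGrad (fun ξ => L (z, ξ)) ξ) (coalgGrad (fun ξ => F (z, ξ)) ξ)) +
      baseDeriv L z ξ (N (coalgGrad (fun ξ => F (z, ξ)) ξ) (coalgGrad (fun ξ => K (z, ξ)) ξ)) := by
  let φ := chartAt (EuclideanSpace ℝ (Fin p)) z
  have hφ : φ ∈ IsManifold.maximalAtlas (𝓡 p) ∞ M := IsManifold.chart_mem_maximalAtlas z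
  have hz : z ∈ φ.source := mem_chart_source _ z
  have hx := φ.map_source hz
  have hYd : DifferentiableAt ℝ (chartFamily φ Y) (φ z) :=
    ((contDiffOn_chartFamily hφ hY).contDiffAt (φ.open_target.mem_nhds hx)).differentiableAt
      (by simp)
  have hd : ∀ {A : M × LieCoalg r → ℝ},
      ContMDiff ((𝓡 p).prod 𝓘(ℝ, LieCoalg r)) 𝓘(ℝ, ℝ) ∞ A →
      ContDiffAt ℝ 2 (chartFun φ A) (φ z, ξ) := fun hA =>
    (contDiffAt_chartFun hφ hA (q := (φ z, ξ)) hx).of_le ENat.LEInfty.out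
  let N' : EuclideanSpace ℝ (Fin r) → EuclideanSpace ℝ (Fin r) → EuclideanSpace ℝ (Fin p) :=
    fun v w => chartDeriv φ z (N v w)
  have hN' : ∀ v w, N' v w = fderiv ℝ (chartFamily φ Y) (φ z) (chartFamily φ Y (φ z) v) w -
        fderiv ℝ (chartFamily φ Y) (φ z) (chartFamily φ Y (φ z) w) v -
        c • chartFamily φ Y (φ z) (lieBracketCLM r G v w) := fun v w =>
    (congrArg (chartDeriv φ z) (hN v w)).trans (chartDeriv_mlieBracket_sub hφ hY hz v w)
  rw [familyBracket_familyBracket_eq hφ hY hF hK hL hz,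
    familyBracket_familyBracket_eq hφ hY hK hL hF hz,
    familyBracket_familyBracket_eq hφ hY hL hF hK hz]
  have h := jacobiator_semidirectBivector (P := ContinuousLinearMap.id ℝ (LieCoalg r))
    (q := (φ z, ξ)) apply_coGrad Function.surjective_id lieBracketCLM_skew
    lieBracketCLM_jacobi hYd (hd hF) (hd hK) (hd hL) hN'
  rw [h, coGrad_fderiv_chartFun hφ hF hz, coGrad_fderiv_chartFun hφ hK hz,
    coGrad_fderiv_chartFun hφ hL hz, fderiv_chartFun_inl hφ hF hz, fderiv_chartFun_inl hφ hK hz,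
    fderiv_chartFun_inl hφ hL hz]

end PoissonFamily

/-! ### Poisson brackets on `C^∞(M × 𝔤*)` -/

section TestFunctions

variable {p : ℕ} {M : Type*} [TopologicalSpace M] [ChartedSpace (EuclideanSpace ℝ (Fin p)) M]
  [IsManifold (𝓡 p) ∞ M]

/-- Covectors extend to differentials of globally defined functions. -/
theorem exists_contMDiff_mfderiv_eq [T2Space M] (z : M) (i : Fin p) :
    ∃ f : M → ℝ, ContMDiff (𝓡 p) 𝓘(ℝ, ℝ) ∞ f ∧ ∀ w : TangentSpace (𝓡 p) z,
      mfderiv (𝓡 p) 𝓘(ℝ, ℝ) f z w =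
        chartDeriv (chartAt (EuclideanSpace ℝ (Fin p)) z) z w i := by
  let φ := chartAt (EuclideanSpace ℝ (Fin p)) z
  have hφ : φ ∈ IsManifold.maximalAtlas (𝓡 p) ∞ M := IsManifold.chart_mem_maximalAtlas z
  have hz : z ∈ φ.source := mem_chart_source _ z
  let π : EuclideanSpace ℝ (Fin p) →L[ℝ] ℝ := EuclideanSpace.proj i
  let χ : SmoothBumpFunction (𝓡 p) z := Classical.arbitrary _
  have hg : ContMDiffOn (𝓡 p) 𝓘(ℝ, ℝ) ∞ (π ∘ φ) φ.source := fun y hy =>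
    (π.contMDiff.contMDiffAt.comp y (contMDiffAt_of_mem_maximalAtlas hφ hy)).contMDiffWithinAt
  refine ⟨fun y => χ y • (π ∘ φ) y, χ.contMDiff_smul hg, fun w => ?_⟩
  have h1 : (fun y => χ y • (π ∘ φ) y) =ᶠ[𝓝 z] π ∘ φ := by
    filter_upwards [χ.eventuallyEq_one] with y hy
    rw [hy, Pi.one_apply, one_smul]
  have h2 := mfderiv_comp z (π.mdifferentiableAt (x := φ z))
    ((mdifferentiable_of_mem_maximalAtlas hφ).mdifferentiableAt hz)
  rw [← h1.mfderiv_eq, mfderiv_eq_fderiv, π.fderiv] at h2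
  exact DFunLike.congr_fun h2 w

end TestFunctions

section IsPoissonBracket

variable {r p : ℕ}
  {G : Type*} [TopologicalSpace G] [ChartedSpace (EuclideanSpace ℝ (Fin r)) G] [Group G]
  [LieGroup (𝓡 r) ∞ G]
  {M : Type*} [TopologicalSpace M] [ChartedSpace (EuclideanSpace ℝ (Fin p)) M]
  [IsManifold (𝓡 p) ∞ M]
  {Y : ∀ z : M, LieAlg r G →L[ℝ] TangentSpace (𝓡 p) z} {c : ℝ}

/-- If `Y` is a homomorphism of Lie algebras up to the factor `c`, its bracket is Poisson. -/
theorem isPoissonBracket_familyBracket (hY : ∀ v, SmoothField fun z => Y z v)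
    (h : ∀ z v w, VectorField.mlieBracket (𝓡 p) (fun y => Y y v) (fun y => Y y w) z =
      c • Y z ⁅v, w⁆) :
    IsPoissonBracket ((𝓡 p).prod 𝓘(ℝ, LieCoalg r)) (familyBracket Y c) where
  smooth F K hF hK := contMDiff_familyBracket hY hF hK
  skew F K hF hK := by
    funext ⟨z, ξ⟩
    have hφ := IsManifold.chart_mem_maximalAtlas (I := 𝓡 p) (n := ∞) z
    have hz := mem_chart_source (EuclideanSpace ℝ (Fin p)) z
    rw [Pi.neg_apply, familyBracket_eq_semidirectBivector hφ hF hK hz,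
      familyBracket_eq_semidirectBivector hφ hK hF hz,
      semidirectBivector_skew lieBracketCLM_skew]
  linear a b F K L hF hK hL := by
    funext ⟨z, ξ⟩
    have hφ := IsManifold.chart_mem_maximalAtlas (I := 𝓡 p) (n := ∞) z
    have hz := mem_chart_source (EuclideanSpace ℝ (Fin p)) z
    have hs : ∀ (a : ℝ) {A : M × LieCoalg r → ℝ},
        ContMDiff ((𝓡 p).prod 𝓘(ℝ, LieCoalg r)) 𝓘(ℝ, ℝ) ∞ A →
        ContMDiff ((𝓡 p).prod 𝓘(ℝ, LieCoalg r)) 𝓘(ℝ, ℝ) ∞ (a • A) :=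
      fun a _ hA => contMDiff_const.mul hA
    have hFK : ContMDiff ((𝓡 p).prod 𝓘(ℝ, LieCoalg r)) 𝓘(ℝ, ℝ) ∞ (a • F + b • K) :=
      (hs a hF).add (hs b hK)
    have hd := (((hasFDerivAt_chartFun hφ hF hz ξ).const_smul a).add
      ((hasFDerivAt_chartFun hφ hK hz ξ).const_smul b)).fderiv
    rw [Pi.add_apply, Pi.smul_apply, Pi.smul_apply,
      familyBracket_eq_semidirectBivector hφ hFK hL hz,
      familyBracket_eq_semidirectBivector hφ hF hL hz,
      familyBracket_eq_semidirectBivector hφ hK hL hz]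
    refine Eq.trans ?_ (semidirectBivector_linear_left _ _ _ _ _ _)
    rw [← hd]
    rfl
  jacobi F K L hF hK hL := by
    funext ⟨z, ξ⟩
    have := jacobiator_familyBracket (N := fun _ _ => 0) hY hF hK hL z ξ
      (fun v w => by rw [h, sub_self])
    simpa using this
  leibniz F K L hF hK hL := by
    funext ⟨z, ξ⟩
    have hφ := IsManifold.chart_mem_maximalAtlas (I := 𝓡 p) (n := ∞) z
    have hz := mem_chart_source (EuclideanSpace ℝ (Fin p)) z
    have hd := ((hasFDerivAt_chartFun hφ hK hz ξ).mul (hasFDerivAt_chartFun hφ hL hz ξ)).fderiv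
    have hv : ∀ A : M × LieCoalg r → ℝ, chartFun (chartAt (EuclideanSpace ℝ (Fin p)) z) A
        (chartAt (EuclideanSpace ℝ (Fin p)) z z, ξ) = A (z, ξ) := fun A => by
      simp [chartFun]
    rw [hv, hv] at hd
    rw [Pi.add_apply, Pi.mul_apply, Pi.mul_apply,
      familyBracket_eq_semidirectBivector hφ hF (hK.mul hL) hz,
      familyBracket_eq_semidirectBivector hφ hF hK hz,
      familyBracket_eq_semidirectBivector hφ hF hL hz, add_comm, mul_comm _ (L (z, ξ))]
    refine Eq.trans ?_ (semidirectBivector_linear_right lieBracketCLM_skew _ _ _ _ _ _)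
    rw [← hd]
    rfl

/-- The Jacobi identity for a function on `M` and two linear functions on `𝔤*` forces `Y` to be a
homomorphism up to the factor `c`. -/
theorem IsPoissonBracket.mlieBracket_eq [T2Space M] (hY : ∀ v, SmoothField fun z => Y z v)
    (h : IsPoissonBracket ((𝓡 p).prod 𝓘(ℝ, LieCoalg r)) (familyBracket Y c)) (z : M)
    (v w : LieAlg r G) :
    VectorField.mlieBracket (𝓡 p) (fun y => Y y v) (fun y => Y y w) z = c • Y z ⁅v, w⁆ := by
  rw [← sub_eq_zero]
  apply chartDeriv_injective (IsManifold.chart_mem_maximalAtlas (I := 𝓡 p) (n := ∞) z)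
    (mem_chart_source (EuclideanSpace ℝ (Fin p)) z)
  rw [map_zero]
  ext i
  obtain ⟨f, hf, hfd⟩ := exists_contMDiff_mfderiv_eq z i
  have hlin : ∀ v : EuclideanSpace ℝ (Fin r), ContMDiff ((𝓡 p).prod 𝓘(ℝ, LieCoalg r)) 𝓘(ℝ, ℝ) ∞
      (fun q : M × LieCoalg r => q.2 v) := fun v =>
    (ContinuousLinearMap.apply ℝ ℝ v).contMDiff.comp contMDiff_snd
  have hF : ContMDiff ((𝓡 p).prod 𝓘(ℝ, LieCoalg r)) 𝓘(ℝ, ℝ) ∞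
      (fun q : M × LieCoalg r => f q.1) := hf.comp contMDiff_fst
  obtain ⟨N, hN⟩ : ∃ N : LieAlg r G → LieAlg r G → TangentSpace (𝓡 p) z, ∀ v w, N v w =
      VectorField.mlieBracket (𝓡 p) (fun y => Y y v) (fun y => Y y w) z - c • Y z ⁅v, w⁆ :=
    ⟨_, fun _ _ => rfl⟩
  have h3 : ∀ v : EuclideanSpace ℝ (Fin r), baseDeriv (fun q : M × LieCoalg r => q.2 v) z 0 = 0 :=
    fun v => mfderiv_const (I := 𝓡 p) (M := M) (c := (0 : ℝ))
  have key : ∀ v w : EuclideanSpace ℝ (Fin r),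
      baseDeriv (fun q : M × LieCoalg r => f q.1) z 0 (N v w) = 0 := fun v w => by
    have h1 := jacobiator_familyBracket hY hF (hlin v) (hlin w) z 0 hN
    rw [h3, h3, coalgGrad_eval, coalgGrad_eval, zero_apply, zero_apply, add_zero, add_zero] at h1
    exact h1.symm.trans (congrFun (h.jacobi _ _ _ hF (hlin v) (hlin w)) (z, 0))
  rw [← hfd, ← hN]
  exact key v w

end IsPoissonBracket

/-! ### Compatibility -/

section FieldAlgebra

variable {p : ℕ} {M : Type*} [TopologicalSpace M] [ChartedSpace (EuclideanSpace ℝ (Fin p)) M]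
  [IsManifold (𝓡 p) ∞ M]

theorem SmoothField.mdifferentiableAt {V : Π z : M, TangentSpace (𝓡 p) z} (hV : SmoothField V)
    (z : M) : MDifferentiableAt (𝓡 p) (𝓡 p).tangent
      (fun z => (⟨z, V z⟩ : TangentBundle (𝓡 p) M)) z :=
  (hV z).mdifferentiableAt (by simp)

theorem SmoothField.add {V W : Π z : M, TangentSpace (𝓡 p) z} (hV : SmoothField V)
    (hW : SmoothField W) : SmoothField (V + W) :=
  ContMDiff.add_section hV hW

theorem SmoothField.const_smul {V : Π z : M, TangentSpace (𝓡 p) z} (hV : SmoothField V)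
    (a : ℝ) : SmoothField (a • V) :=
  ContMDiff.const_smul_section hV

/-- The mixed terms `[A, D] + [B, C]` cancel, so commutation of differences of fields is a statement
about the brackets of their sums. -/
theorem mlieBracket_parallelogram {A B C D : Π z : M, TangentSpace (𝓡 p) z} (hA : SmoothField A)
    (hB : SmoothField B) (hC : SmoothField C) (hD : SmoothField D) (z : M) :
    VectorField.mlieBracket (𝓡 p) (A + B) (C + D) z +
      VectorField.mlieBracket (𝓡 p) (A + (-1 : ℝ) • B) (C + (-1 : ℝ) • D) z =
    (2 : ℝ) • VectorField.mlieBracket (𝓡 p) A C z +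
      (2 : ℝ) • VectorField.mlieBracket (𝓡 p) B D z := by
  have hB' := hB.const_smul (-1)
  have hD' := hD.const_smul (-1)
  rw [VectorField.mlieBracket_add_left (hA.mdifferentiableAt z) (hB.mdifferentiableAt z),
    VectorField.mlieBracket_add_right (hC.mdifferentiableAt z) (hD.mdifferentiableAt z),
    VectorField.mlieBracket_add_right (hC.mdifferentiableAt z) (hD.mdifferentiableAt z),
    VectorField.mlieBracket_add_left (hA.mdifferentiableAt z) (hB'.mdifferentiableAt z),
    VectorField.mlieBracket_add_right (hC.mdifferentiableAt z) (hD'.mdifferentiableAt z),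
    VectorField.mlieBracket_add_right (hC.mdifferentiableAt z) (hD'.mdifferentiableAt z),
    VectorField.mlieBracket_const_smul_right (hD.mdifferentiableAt z),
    VectorField.mlieBracket_const_smul_right (hD.mdifferentiableAt z),
    VectorField.mlieBracket_const_smul_left (hB.mdifferentiableAt z),
    VectorField.mlieBracket_const_smul_left (hB.mdifferentiableAt z)]
  module

/-- Commutativity of a family can be tested on a basis. -/
theorem commuteAt_iff_basis {r : ℕ} {V : Type*} [AddCommGroup V] [Module ℝ V] [TopologicalSpace V]
    {X : ∀ z : M, V →L[ℝ] TangentSpace (𝓡 p) z} (hX : ∀ v, SmoothField fun z => X z v)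
    (b : Module.Basis (Fin r) ℝ V) (z : M) :
    CommuteAt X z ↔ ∀ i j, VectorField.mlieBracket (𝓡 p) (fun y => X y (b i))
      (fun y => X y (b j)) z = 0 := by
  refine ⟨fun h i j => h _ _, fun h => ?_⟩
  have hadd : ∀ v w, (fun z => X z (v + w)) = (fun z => X z v) + fun z => X z w := fun v w =>
    funext fun z => map_add _ _ _
  have hsmul : ∀ (a : ℝ) v, (fun z => X z (a • v)) = a • fun z => X z v := fun a v =>
    funext fun z => map_smul _ _ _
  let β : V →ₗ[ℝ] V →ₗ[ℝ] TangentSpace (𝓡 p) z := LinearMap.mk₂ ℝ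
    (fun v w => VectorField.mlieBracket (𝓡 p) (fun y => X y v) (fun y => X y w) z)
    (fun v v' w => by
      rw [hadd, VectorField.mlieBracket_add_left ((hX v).mdifferentiableAt z)
        ((hX v').mdifferentiableAt z)])
    (fun a v w => by
      rw [hsmul, VectorField.mlieBracket_const_smul_left ((hX v).mdifferentiableAt z)])
    (fun v w w' => by
      rw [hadd, VectorField.mlieBracket_add_right ((hX w).mdifferentiableAt z)
        ((hX w').mdifferentiableAt z)])
    (fun a v w => by
      rw [hsmul, VectorField.mlieBracket_const_smul_right ((hX w).mdifferentiableAt z)])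
  have hβ : β = 0 := b.ext fun i => b.ext fun j => h i j
  intro v w
  exact congrArg (fun β : V →ₗ[ℝ] V →ₗ[ℝ] TangentSpace (𝓡 p) z => β v w) hβ

end FieldAlgebra

section Compatible

variable {s s₁ s₂ : ActionSide} {r p : ℕ}
  {G : Type*} [TopologicalSpace G] [ChartedSpace (EuclideanSpace ℝ (Fin r)) G] [Group G]
  [LieGroup (𝓡 r) ∞ G]
  {M : Type*} [TopologicalSpace M] [ChartedSpace (EuclideanSpace ℝ (Fin p)) M]
  [IsManifold (𝓡 p) ∞ M]

theorem LieGroupAction.isPoissonBracket (a : LieGroupAction s r p G M) :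
    IsPoissonBracket ((𝓡 p).prod 𝓘(ℝ, LieCoalg r)) a.poissonBracket := by
  rw [a.poissonBracket_eq_familyBracket]
  exact isPoissonBracket_familyBracket a.smoothField_rightGenerator fun z v w => by
    rw [a.mlieBracket_rightGenerator, one_smul]

variable (a₁ : LieGroupAction s₁ r p G M) (a₂ : LieGroupAction s₂ r p G M)

omit [LieGroup (𝓡 r) ∞ G] [IsManifold (𝓡 p) ∞ M] in
/-- In terms of generators of right type, the difference of the generators is `Y₁ - Y₂` up to sign,
whatever the sides of the actions. -/
theorem generatorDiff_eq (z : M) : generatorDiff a₁ a₂ z =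
    -s₁.sign • (a₁.rightGenerator z + (-1 : ℝ) • a₂.rightGenerator z) := by
  have h1 : s₁.sign * s₁.sign = 1 := by cases s₁ <;> norm_num [ActionSide.sign]
  simp only [generatorDiff, LieGroupAction.rightGenerator, smul_add, smul_smul]
  rw [neg_mul_neg, h1, one_smul, sub_eq_add_neg, ← neg_smul]
  congr 2
  ring

omit [LieGroup (𝓡 r) ∞ G] [IsManifold (𝓡 p) ∞ M] in
theorem generatorDiff_apply_eq (v : LieAlg r G) : (fun z => generatorDiff a₁ a₂ z v) =
    -s₁.sign • ((fun z => a₁.rightGenerator z v) +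
      (-1 : ℝ) • fun z => a₂.rightGenerator z v) := by
  funext z
  rw [generatorDiff_eq]
  rfl

theorem smoothField_generatorDiff (v : LieAlg r G) :
    SmoothField fun z => generatorDiff a₁ a₂ z v := by
  rw [generatorDiff_apply_eq]
  exact ((a₁.smoothField_rightGenerator v).add
    ((a₂.smoothField_rightGenerator v).const_smul _)).const_smul _

/-- The fields `X(v)`, `X(w)` commute exactly if `Y = Y₁ + Y₂` satisfies `[Y v, Y w] = 2 Y [v, w]`,
which is the Jacobi identity of the sum of the brackets. -/
theorem mlieBracket_generatorDiff (v w : LieAlg r G) (z : M) :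
    VectorField.mlieBracket (𝓡 p) (fun y => generatorDiff a₁ a₂ y v)
        (fun y => generatorDiff a₁ a₂ y w) z =
      (2 : ℝ) • (a₁.rightGenerator z + a₂.rightGenerator z) ⁅v, w⁆ -
        VectorField.mlieBracket (𝓡 p) (fun y => (a₁.rightGenerator y + a₂.rightGenerator y) v)
          (fun y => (a₁.rightGenerator y + a₂.rightGenerator y) w) z := by
  have h1 : -s₁.sign * -s₁.sign = 1 := by cases s₁ <;> norm_num [ActionSide.sign]
  have hd := fun v => (a₁.smoothField_rightGenerator v).add
    ((a₂.smoothField_rightGenerator v).const_smul (-1))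
  have h := mlieBracket_parallelogram (a₁.smoothField_rightGenerator v)
    (a₂.smoothField_rightGenerator v) (a₁.smoothField_rightGenerator w)
    (a₂.smoothField_rightGenerator w) z
  rw [a₁.mlieBracket_rightGenerator, a₂.mlieBracket_rightGenerator] at h
  rw [generatorDiff_apply_eq, generatorDiff_apply_eq,
    VectorField.mlieBracket_const_smul_left ((hd v).mdifferentiableAt z),
    VectorField.mlieBracket_const_smul_right ((hd w).mdifferentiableAt z), smul_smul, h1, one_smul,
    eq_sub_iff_add_eq', add_apply, smul_add]
  exact h

/-- The brackets of the actions are always Poisson, so only the Jacobi identity of their sum is at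
stake. -/
theorem poissonCompatible_iff [T2Space M] :
    PoissonCompatible ((𝓡 p).prod 𝓘(ℝ, LieCoalg r)) a₁.poissonBracket a₂.poissonBracket ↔
      ∀ z : M, CommuteAt (generatorDiff a₁ a₂) z := by
  have hY : ∀ v, SmoothField fun z => (a₁.rightGenerator z + a₂.rightGenerator z) v := fun v =>
    (a₁.smoothField_rightGenerator v).add (a₂.smoothField_rightGenerator v)
  have hsum : (fun F K => a₁.poissonBracket F K + a₂.poissonBracket F K) =
      familyBracket (fun z => a₁.rightGenerator z + a₂.rightGenerator z) 2 := by
    funext F K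
    rw [a₁.poissonBracket_eq_familyBracket, a₂.poissonBracket_eq_familyBracket,
      familyBracket_add, one_add_one_eq_two]
  rw [PoissonCompatible, hsum]
  constructor
  · rintro ⟨-, -, h⟩ z v w
    rw [mlieBracket_generatorDiff, h.mlieBracket_eq hY, sub_self]
  · intro h
    refine ⟨a₁.isPoissonBracket, a₂.isPoissonBracket,
      isPoissonBracket_familyBracket hY fun z v w => ?_⟩
    have := h z v w
    rw [mlieBracket_generatorDiff, sub_eq_zero] at this
    exact this.symm

end Compatible

end

theorem mainTheorem2 (r p : ℕ)
    (G : Type*) [TopologicalSpace G] [ChartedSpace (EuclideanSpace ℝ (Fin r)) G] [Group G]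
    [LieGroup (𝓡 r) ∞ G]
    (M : Type*) [TopologicalSpace M] [T2Space M] [ChartedSpace (EuclideanSpace ℝ (Fin p)) M]
    [IsManifold (𝓡 p) ∞ M]
    (s₁ s₂ : ActionSide) (a₁ : LieGroupAction s₁ r p G M) (a₂ : LieGroupAction s₂ r p G M)
    (b : Module.Basis (Fin r) ℝ (LieAlg r G)) :
    -- compatibility means that the fields `X(v_i)` commute, equivalently `X(𝔤)` is commutative
    (PoissonCompatible ((𝓡 p).prod 𝓘(ℝ, LieCoalg r)) a₁.poissonBracket a₂.poissonBracket ↔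
      ∀ (i j : Fin r) (z : M),
      VectorField.mlieBracket (𝓡 p) (fun y => generatorDiff a₁ a₂ y (b i))
        (fun y => generatorDiff a₁ a₂ y (b j)) z = 0) ∧
    (PoissonCompatible ((𝓡 p).prod 𝓘(ℝ, LieCoalg r)) a₁.poissonBracket a₂.poissonBracket ↔
      ∀ z : M, CommuteAt (generatorDiff a₁ a₂) z) ∧
    -- and this is detected at the points around which the rank is constant
    (PoissonCompatible ((𝓡 p).prod 𝓘(ℝ, LieCoalg r)) a₁.poissonBracket a₂.poissonBracket ↔
      ∀ (z₀ : M) (l : ℕ) (σ : Fin l → Fin r),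
      (∀ᶠ z in 𝓝 z₀, familyRank (generatorDiff a₁ a₂) z = l) →
      LinearIndependent ℝ (fun i => generatorDiff a₁ a₂ z₀ (b (σ i))) →
        IsLeafwiseTranslation (generatorDiff a₁ a₂) b σ z₀) ∧
    -- local form around a point where the rank is constant
    (∀ (z₀ : M) (l : ℕ) (σ : Fin l → Fin r),
      (∀ᶠ z in 𝓝 z₀, familyRank (generatorDiff a₁ a₂) z = l) →
      LinearIndependent ℝ (fun i => generatorDiff a₁ a₂ z₀ (b (σ i))) →
        ((∀ᶠ z in 𝓝 z₀, CommuteAt (generatorDiff a₁ a₂) z) ↔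
          IsLeafwiseTranslation (generatorDiff a₁ a₂) b σ z₀) ∧
        ((∀ v : LieAlg r G, generatorDiff a₁ a₂ z₀ v = 0 → ∀ᶠ z in 𝓝 z₀, generatorDiff a₁ a₂ z v = 0) →
          ((∀ᶠ z in 𝓝 z₀, CommuteAt (generatorDiff a₁ a₂) z) ↔
          IsTranslation (generatorDiff a₁ a₂) b σ z₀))) := by
  have hX := smoothField_generatorDiff a₁ a₂
  have hiff := poissonCompatible_iff a₁ a₂
  refine ⟨?_, hiff, ?_, ?_⟩
  · rw [hiff]
    exact ⟨fun h i j z => h z _ _, fun h z => (commuteAt_iff_basis hX b z).2 fun i j => h i j z⟩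
  · rw [hiff]
    exact ⟨fun h z₀ l σ hr hli =>
        isLeafwiseTranslation_of_commuteAt hX hr hli (Eventually.of_forall h),
      fun h => commuteAt_of_constant_rank hX b fun z₀ l σ hr hli =>
        (h z₀ l σ hr hli).eventually_commuteAt hX⟩
  · intro z₀ l σ hr hli
    have h := isLeafwiseTranslation_of_commuteAt hX hr hli
    exact ⟨⟨h, fun h => h.eventually_commuteAt hX⟩, fun hvan =>
      ⟨fun hc => (h hc).isTranslation hvan,
        fun ht => ht.isLeafwiseTranslation.eventually_commuteAt hX⟩⟩
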